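/- Let $(\Omega,\mathcal F,\mathbb P)$ be a probability space and let $\{a_n\}_{n\in\mathbb Z^2}$ be independent real random variables with $\mathbb E a_n=0$, $\operatorname{Var}(a_n)=1$ and $|a_n|\le M$ almost surely for all $n$, where $M$ is a constant. Put $Q_0=[0,1)^2$, $Q_n=n+Q_0$ and $\omega_0=\sum_{n\in\mathbb Z^2}a_n\mathbf 1_{Q_n}$. For $z=(z_1,z_2)$ let $z^\perp=(-z_2,z_1)$, let $K(z)=\frac{z^\perp}{2\pi|z|^2}$ be the Biot–Savart kernel, and let $$v(x)=K*\mathbf 1_{Q_0}(x)=\frac1{2\pi}\int_{Q_0}\frac{(x-y)^\perp}{|x-y|^2}\,dy .$$ Write $B_N=\{x\in\mathbb R^2:|x|<N\}$ and $\ln^-z=-\min\{0,\ln z\}$. There are constants $C_p$, depending only on $p$ and $M$, and a jointly measurable random velocity field $u_0:\Omega\times\mathbb R^2\to\mathbb R^2$ such that the following hold. 1. For every $N\in\mathbb N$, $u_0\in L^2(\Omega\times B_N)$ and the series $$u_0(x)=\sum_{n\in\mathbb Z^2}a_n\bigl(v(x-n)-v(-n)\bigr)$$ converges (unconditionally) to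 $u_0$ in $L^2(\Omega\times B_N)$. 2. Almost surely $u_0\in L^2_{\mathrm{loc}}(\mathbb R^2)$ and, in the sense of distributions, $\operatorname{div}u_0=0$ and $\operatorname{curl}u_0=\partial_1u_{0,2}-\partial_2u_{0,1}=\omega_0$ in $H^{-1}_{\mathrm{loc}}(\mathbb R^2)$. 3. For every $p\in[1,\infty)$ and all $x,y\in\mathbb R^2$, $$\bigl(\mathbb E|u_0(x)-u_0(y)|^p\bigr)^{1/p}\le \frac{C_p\,|x-y|\,(1+\ln^-|x-y|)}{1+|x-y|}\,\bigl(\ln(e+|x|+|y|)\bigr)^{1/2},$$ where the right-hand side is read as $0$ for $x=y$. 4. $u_0$ is unique up to addition of (random) constants: if $w:\Omega\times\mathbb R^2\to\mathbb R^2$ is jointly measurable, satisfies 2 almost surely, and satisfies the bound in 3 for some $p\in[1,\infty)$ with some constant in place of $C_p$, then almost surely there is $c\in\mathbb R^2$ with $w=u_0+c$ almost everywhere on $\mathbb R^2$. -/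

import Mathlib

open MeasureTheory ProbabilityTheory Filter Topology
open scoped ENNReal Distributions LineDeriv

noncomputable section

namespace RandomVorticity

/-- The Euclidean plane. -/
abbrev Plane : Type := EuclideanSpace ℝ (Fin 2)

/-- The lattice `ℤ²`. -/
abbrev Lattice : Type := Fin 2 → ℤ

/-- The inclusion of `ℤ²` into the plane. -/
def latticePoint (n : Lattice) : Plane := WithLp.toLp 2 (fun i => (n i : ℝ))

/-- The half-open unit square `Q_n = n + [0, 1)²`. -/
def unitSquare (n : Lattice) : Set Plane :=
  {x | ∀ i, (n i : ℝ) ≤ x i ∧ x i < (n i : ℝ) + 1}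

/-- The rotation `(z₁, z₂)^⊥ = (-z₂, z₁)`. -/
def perp (z : Plane) : Plane := !₂[-z 1, z 0]

/-- The Biot–Savart kernel `K(z) = z^⊥ / (2 π |z|²)`. -/
def biotSavart (z : Plane) : Plane := (1 / (2 * Real.pi * ‖z‖ ^ 2)) • perp z

/-- The velocity field `v = K * 1_{Q_0}` of the unit vortex patch. -/
def patchVelocity (x : Plane) : Plane := ∫ y in unitSquare 0, biotSavart (x - y)

/-- The renormalized patch velocity `v(x - n) - v(-n)`: its vorticity is `1_{Q_n}`, and it
vanishes at the origin. -/
def renormalizedPatch (n : Lattice) (x : Plane) : Plane :=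
  patchVelocity (x - latticePoint n) - patchVelocity (-latticePoint n)

/-- The vorticity `∑ₙ aₙ 1_{Q_n}` with deterministic weights `a` (the squares partition
the plane, so at each point at most one summand is nonzero). -/
def vorticity (a : Lattice → ℝ) (x : Plane) : ℝ :=
  ∑' n : Lattice, (unitSquare n).indicator (fun _ => a n) x

/-- The distribution `φ ↦ ∫ f φ` on the plane, for a locally integrable `f`. -/
def toDistribution (f : Plane → ℝ) : 𝓓'((⊤ : TopologicalSpace.Opens Plane), ℝ) :=
  TestFunction.integralAgainstBilinCLM (ContinuousLinearMap.mul ℝ ℝ) volume f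

/-- The coordinate directions. -/
def basisVec (i : Fin 2) : Plane := EuclideanSpace.single i 1

/-- The distributional divergence `∂₁ u₁ + ∂₂ u₂`. -/
def distDiv (u : Plane → Plane) : 𝓓'((⊤ : TopologicalSpace.Opens Plane), ℝ) :=
  ∂_{basisVec 0} (toDistribution fun x => u x 0) + ∂_{basisVec 1} (toDistribution fun x => u x 1)

/-- The distributional curl `∂₁ u₂ - ∂₂ u₁`. -/
def distCurl (u : Plane → Plane) : 𝓓'((⊤ : TopologicalSpace.Opens Plane), ℝ) :=
  ∂_{basisVec 0} (toDistribution fun x => u x 1) - ∂_{basisVec 1} (toDistribution fun x => u x 0)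

/-- The norm of a test function in `H¹`. -/
def sobolevNorm (φ : 𝓓((⊤ : TopologicalSpace.Opens Plane), ℝ)) : ℝ :=
  Real.sqrt ((∫ x, (φ x) ^ 2) + ∫ x, ‖gradient φ x‖ ^ 2)

/-- `T ∈ H⁻¹_loc`: on every ball `B_R`, `T` is a bounded functional for the `H¹` norm on the test
functions supported in that ball, i.e. it restricts to an element of `H⁻¹(B_R) = (H¹₀(B_R))'`. -/
def MemHNegOneLoc (T : 𝓓'((⊤ : TopologicalSpace.Opens Plane), ℝ)) : Prop :=
  ∀ R : ℝ, ∃ C : ℝ, ∀ φ : 𝓓((⊤ : TopologicalSpace.Opens Plane), ℝ),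
    tsupport φ ⊆ Metric.ball 0 R → |T φ| ≤ C * sobolevNorm φ

/-- Equality of two distributions as elements of `H⁻¹_loc`. -/
def EqHNegOneLoc (S T : 𝓓'((⊤ : TopologicalSpace.Opens Plane), ℝ)) : Prop :=
  MemHNegOneLoc S ∧ MemHNegOneLoc T ∧ S = T

/-- `u ∈ L²_loc`. -/
def MemL2Loc (u : Plane → Plane) : Prop :=
  ∀ R : ℝ, MemLp u 2 (volume.restrict (Metric.ball 0 R))

/-- `u` is an `L²_loc` solution of `div u = 0`, `curl u = ω` in `H⁻¹_loc`. -/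
structure IsVelocityOf (ω : Plane → ℝ) (u : Plane → Plane) : Prop where
  memL2Loc : MemL2Loc u
  div_eq : EqHNegOneLoc (distDiv u) 0
  curl_eq : EqHNegOneLoc (distCurl u) (toDistribution ω)

/-- `ln⁻ z = -min {0, ln z}`. -/
def logNeg (z : ℝ) : ℝ := -min 0 (Real.log z)

/-- `|x - y| (1 + ln⁻ |x - y|) / (1 + |x - y|) · (ln (e + |x| + |y|))^{1/2}`
(equal to `0` for `x = y`). -/
def growthModulus (x y : Plane) : ℝ :=
  ‖x - y‖ * (1 + logNeg ‖x - y‖) / (1 + ‖x - y‖)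
    * Real.sqrt (Real.log (Real.exp 1 + ‖x‖ + ‖y‖))

/-- `(E |u(x) - u(y)|^p)^{1/p} ≤ C · growthModulus x y` for all points `x`, `y`. -/
def IncrementBound {Ω : Type*} [MeasurableSpace Ω] (μ : Measure Ω) (u : Ω → Plane → Plane)
    (p C : ℝ) : Prop :=
  ∀ x y : Plane,
    eLpNorm (fun ω => u ω x - u ω y) (ENNReal.ofReal p) μ ≤ ENNReal.ofReal (C * growthModulus x y)

end RandomVorticity

end

noncomputable section

namespace RandomVorticity

open Real

section

/-! ### Polar coordinates in the plane -/

/-! The construction rests on one deterministic estimate, `norm_patchVelocity_sub_le`: up to a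
constant, the increment of `v` between `x` and `y` is at most `|x-y| (1 + ln⁻|x-y|) /
((1+|x|)(1+|y|))`. It follows from the inversion identity `|K(z)-K(w)| = |z-w| / (2π|z||w|)`; the
logarithm is the price of two simple poles close together, and the denominator is the decay away
from the square.

The increment of the `n`-th summand therefore decays like `|n|⁻²`. This is square summable over `ℤ²`
but not summable, so convergence has to come from the independence of the centred weights. The sum
of squares is `sum_lattice_le`: seen from `x`, the shells of radius `r < |x-y|` contribute about
`1/r` each and the farther ones converge, which produces a logarithm. Bounded independent weights
make finite sums subgaussian (Hoeffding), so every `L^p` norm is controlled by the `ℓ²` norm of the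
coefficients (`eLpNorm_sum_le`). The field is the limit along finite sets with geometrically small
`ℓ²` tails, and Fatou's lemma carries the moment bounds to the limit.

For the equations, polar coordinates show that `K` has divergence `0` and curl `δ₀`. Fubini gives
the statement for each patch, and convergence in `L²` on balls, almost surely along the exhaustion,
gives it for the sum.

For uniqueness, the difference of two fields has neither divergence nor curl, so `u₁ - i u₂` becomes
entire after mollification. Cauchy's formula on a circle of radius `R` bounds its derivative by
`1/R` times an angular integral of increments. The expectation of this is `O(R^{-1/2})`, so by Fatou
it has liminf `0` almost surely along integer radii, and the derivative vanishes. Only growth in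
mean is used, never growth of individual samples. -/

lemma volume_preserving_pair :
    MeasurePreserving (fun p : ℝ × ℝ => (!₂[p.1, p.2] : Plane)) volume volume :=
  (PiLp.volume_preserving_toLp (Fin 2)).comp (volume_preserving_finTwoArrow ℝ).symm

lemma measurableEmbedding_pair :
    MeasurableEmbedding (fun p : ℝ × ℝ => (!₂[p.1, p.2] : Plane)) :=
  (MeasurableEquiv.toLp 2 (Fin 2 → ℝ)).measurableEmbedding.comp
    (MeasurableEquiv.finTwoArrow (α := ℝ)).symm.measurableEmbedding

lemma lintegral_polar (f : Plane → ℝ≥0∞) :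
    ∫⁻ z, f z = ∫⁻ p in polarCoord.target,
      ENNReal.ofReal p.1 * f !₂[p.1 * cos p.2, p.1 * sin p.2] := by
  rw [← volume_preserving_pair.lintegral_comp_emb measurableEmbedding_pair,
    ← lintegral_comp_polarCoord_symm]
  rfl

lemma integral_polar (f : Plane → ℝ) :
    ∫ z, f z = ∫ p in polarCoord.target, p.1 * f !₂[p.1 * cos p.2, p.1 * sin p.2] := by
  rw [← volume_preserving_pair.integral_comp measurableEmbedding_pair,
    ← integral_comp_polarCoord_symm]
  rfl

lemma norm_polar {r : ℝ} (hr : 0 < r) (θ : ℝ) : ‖(!₂[r * cos θ, r * sin θ] : Plane)‖ = r := by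
  rw [EuclideanSpace.norm_eq]
  simp only [Fin.sum_univ_two, norm_eq_abs, sq_abs]
  rw [sqrt_eq_iff_mul_self_eq (by positivity) hr.le]
  simp
  linear_combination (r ^ 2) * (sin_sq_add_cos_sq θ)

lemma lintegral_radial {f : ℝ → ℝ≥0∞} (hf : Measurable f) :
    ∫⁻ z : Plane, f ‖z‖ =
      ENNReal.ofReal (2 * π) * ∫⁻ r in Set.Ioi (0 : ℝ), ENNReal.ofReal r * f r := by
  rw [lintegral_polar, polarCoord_target, Measure.volume_eq_prod,
    ← Measure.prod_restrict, lintegral_prod_symm]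
  · have : ∀ θ : ℝ, ∫⁻ r in Set.Ioi (0 : ℝ), ENNReal.ofReal r *
        f ‖(!₂[r * cos θ, r * sin θ] : Plane)‖ = ∫⁻ r in Set.Ioi (0 : ℝ), ENNReal.ofReal r * f r :=
      fun θ => setLIntegral_congr_fun measurableSet_Ioi fun r hr => by rw [norm_polar hr]
    simp only [this]
    rw [lintegral_const, mul_comm]
    congr 1
    rw [Measure.restrict_apply_univ, volume_Ioo]
    congr 1
    ring
  · have : Measurable fun p : ℝ × ℝ => (!₂[p.1 * cos p.2, p.1 * sin p.2] : Plane) :=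
      measurableEmbedding_pair.measurable.comp
        (by fun_prop : Measurable fun p : ℝ × ℝ => (p.1 * cos p.2, p.1 * sin p.2))
    exact ((by fun_prop : Measurable fun p : ℝ × ℝ => ENNReal.ofReal p.1).mul
      (hf.comp this.norm)).aemeasurable

/-! ### The Biot–Savart kernel -/

lemma norm_perp (z : Plane) : ‖perp z‖ = ‖z‖ := by
  simp [EuclideanSpace.norm_eq, perp, Fin.sum_univ_two, add_comm]

lemma perp_sub (z w : Plane) : perp z - perp w = perp (z - w) := by
  ext i; fin_cases i <;> simp [perp]; ring

lemma perp_smul (c : ℝ) (z : Plane) : perp (c • z) = c • perp z := by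
  ext i; fin_cases i <;> simp [perp]

lemma norm_biotSavart (z : Plane) : ‖biotSavart z‖ = 1 / (2 * π * ‖z‖) := by
  rw [biotSavart, norm_smul, norm_perp, norm_of_nonneg (by positivity)]
  by_cases hz : ‖z‖ = 0
  · simp [hz]
  · field_simp

/-- Up to a rotation and a factor, `K` is the inversion `z ↦ z / |z|²`, which distorts distances by
exactly `1 / (|z||w|)`. -/
lemma norm_biotSavart_sub {z w : Plane} (hz : z ≠ 0) (hw : w ≠ 0) :
    ‖biotSavart z - biotSavart w‖ = ‖z - w‖ / (2 * π) * (1 / (‖z‖ * ‖w‖)) := by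
  have h : ∀ z : Plane, biotSavart z = (1 / (2 * π)) • perp ((1 / ‖z‖) ^ 2 • z) := by
    intro z
    rw [biotSavart, perp_smul, smul_smul]
    congr 1
    by_cases hz : ‖z‖ = 0
    · simp [hz]
    · field_simp
  rw [h, h, ← smul_sub, perp_sub, norm_smul, norm_perp, ← dist_eq_norm,
    dist_div_norm_sq_smul hz hw, dist_eq_norm, norm_of_nonneg (by positivity)]
  ring

lemma measurable_perp : Measurable perp := by
  unfold perp
  exact measurableEmbedding_pair.measurable.comp
    (by fun_prop : Measurable fun z : Plane => (-z 1, z 0))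

lemma measurable_biotSavart : Measurable biotSavart := by
  unfold biotSavart
  exact (by fun_prop : Measurable fun z : Plane => 1 / (2 * π * ‖z‖ ^ 2)).smul measurable_perp

/-! ### The unit squares -/

lemma measurableSet_unitSquare (n : Lattice) : MeasurableSet (unitSquare n) := by
  have : unitSquare n = ⋂ i, (fun x : Plane => x i) ⁻¹' Set.Ico (n i : ℝ) (n i + 1) := by
    ext x; simp [unitSquare]
  rw [this]
  exact MeasurableSet.iInter fun i =>
    (by fun_prop : Measurable fun x : Plane => x i) measurableSet_Ico

lemma volume_unitSquare (n : Lattice) : volume (unitSquare n) = 1 := by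
  rw [← (PiLp.volume_preserving_toLp (Fin 2)).measure_preimage
    (measurableSet_unitSquare n).nullMeasurableSet]
  have : (WithLp.toLp 2 : (Fin 2 → ℝ) → Plane) ⁻¹' unitSquare n =
      Set.univ.pi fun i => Set.Ico (n i : ℝ) (n i + 1) := by
    ext x; simp [unitSquare]
  rw [this, volume_pi_pi]
  simp

lemma norm_le_of_mem_unitSquare_zero {q : Plane} (hq : q ∈ unitSquare 0) : ‖q‖ ≤ 2 := by
  have h0 := hq 0
  have h1 := hq 1
  simp at h0 h1
  rw [EuclideanSpace.norm_eq, sqrt_le_left (by norm_num)]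
  simp [Fin.sum_univ_two]
  nlinarith

/-! ### Integrals of singular kernels over the unit square -/

/-- The radial majorant `1 / (r max(r, δ))`. -/
def singularMajorant (δ r : ℝ) : ℝ := 1 / (r * max r δ)

lemma singularMajorant_nonneg {δ r : ℝ} (hr : 0 ≤ r) : 0 ≤ singularMajorant δ r := by
  have : 0 ≤ max r δ := le_max_of_le_left hr
  unfold singularMajorant; positivity

lemma measurable_singularMajorant (δ : ℝ) : Measurable (singularMajorant δ) := by
  unfold singularMajorant; fun_prop

/-- The integrand is `1/δ` up to `δ`, contributing `1`, and `1/r` from there to `2`. -/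
lemma lintegral_inv_max_le {δ : ℝ} (hδ : 0 < δ) (hδ' : δ ≤ 2) :
    ∫⁻ r in Set.Ioo (0 : ℝ) 2, ENNReal.ofReal (1 / max r δ) ≤
      ENNReal.ofReal (1 + log (2 / δ)) := by
  have hcont : Continuous fun r : ℝ => 1 / max r δ :=
    continuous_const.div (by fun_prop) fun r => (lt_max_of_lt_right hδ).ne'
  have hint : ∀ a b, IntervalIntegrable (fun r : ℝ => 1 / max r δ) volume a b :=
    fun a b => hcont.intervalIntegrable a b
  rw [← ofReal_integral_eq_lintegral_ofReal]
  · apply ENNReal.ofReal_le_ofReal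
    rw [← integral_Ioc_eq_integral_Ioo, ← intervalIntegral.integral_of_le (by norm_num),
      ← intervalIntegral.integral_add_adjacent_intervals (hint 0 δ) (hint δ 2)]
    have h1 : ∫ r in (0 : ℝ)..δ, 1 / max r δ = 1 := by
      rw [intervalIntegral.integral_congr (g := fun _ => 1 / δ)]
      · simp [hδ.ne']
      · intro r hr
        rw [Set.uIcc_of_le hδ.le] at hr
        simp [max_eq_right hr.2]
    have h2 : ∫ r in δ..2, 1 / max r δ = log (2 / δ) := by
      rw [← integral_one_div_of_pos hδ (by norm_num)]
      apply intervalIntegral.integral_congr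
      intro r hr
      rw [Set.uIcc_of_le hδ'] at hr
      simp [max_eq_left hr.1]
    rw [h1, h2]
  · exact ((hint 0 2).1).mono_set Set.Ioo_subset_Ioc_self
  · exact ae_of_all _ fun r => by have := lt_max_of_lt_right (b := r) hδ; positivity

/-- Within distance `2` of `x` the square is replaced by the whole disc, where the polar Jacobian
cancels one factor `1/r`. Farther out the majorant is at most `1/4` and the square has area `1`. -/
lemma lintegral_singularMajorant_unitSquare_le {δ : ℝ} (hδ : 0 < δ) (hδ' : δ ≤ 2) (x : Plane) :
    ∫⁻ q in unitSquare 0, ENNReal.ofReal (singularMajorant δ ‖x - q‖) ≤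
      ENNReal.ofReal (2 * π * (1 + log (2 / δ)) + 1 / 4) := by
  have hlog : 0 ≤ log (2 / δ) := log_nonneg (by rw [le_div_iff₀ hδ]; linarith)
  have hpt : ∀ q : Plane, ENNReal.ofReal (singularMajorant δ ‖x - q‖) ≤
      (Set.Iio (2 : ℝ)).indicator (fun r => ENNReal.ofReal (singularMajorant δ r)) ‖q - x‖ +
        ENNReal.ofReal (1 / 4) := by
    intro q
    rw [norm_sub_rev]
    by_cases h : ‖q - x‖ < 2
    · rw [Set.indicator_of_mem (by exact h)]; exact le_self_add
    · rw [Set.indicator_of_notMem (by exact h), zero_add]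
      apply ENNReal.ofReal_le_ofReal
      push Not at h
      have h2 : 2 ≤ max ‖q - x‖ δ := le_max_of_le_left h
      exact one_div_le_one_div_of_le (by norm_num) (by nlinarith)
  set f : ℝ → ℝ≥0∞ := (Set.Iio (2 : ℝ)).indicator fun r => ENNReal.ofReal (singularMajorant δ r)
    with hf
  have hfm : Measurable f :=
    (measurable_singularMajorant δ).ennreal_ofReal.indicator measurableSet_Iio
  calc _ ≤ ∫⁻ q in unitSquare 0, (f ‖q - x‖ + ENNReal.ofReal (1 / 4)) :=
        lintegral_mono hpt
    _ = (∫⁻ q in unitSquare 0, f ‖q - x‖) + ENNReal.ofReal (1 / 4) := by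
        rw [lintegral_add_right _ measurable_const]
        simp [volume_unitSquare]
    _ ≤ (∫⁻ q : Plane, f ‖q - x‖) + ENNReal.ofReal (1 / 4) := by
        gcongr; exact Measure.restrict_le_self
    _ = (∫⁻ q : Plane, f ‖q‖) + ENNReal.ofReal (1 / 4) := by
        rw [lintegral_sub_right_eq_self (fun q : Plane => f ‖q‖) x]
    _ ≤ ENNReal.ofReal (2 * π) * ENNReal.ofReal (1 + log (2 / δ)) + ENNReal.ofReal (1 / 4) := by
        rw [lintegral_radial hfm]
        gcongr
        refine le_trans ?_ (lintegral_inv_max_le hδ hδ')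
        rw [← lintegral_indicator measurableSet_Ioi, ← lintegral_indicator measurableSet_Ioo]
        apply lintegral_mono
        intro r
        by_cases hr : 0 < r
        · by_cases hr2 : r < 2
          · simp only [Set.indicator, Set.mem_Ioi, hr, Set.mem_Ioo, hr2, hf, Set.mem_Iio, if_true,
              and_self]
            rw [← ENNReal.ofReal_mul hr.le]
            apply ENNReal.ofReal_le_ofReal
            unfold singularMajorant
            have := lt_max_of_lt_right (b := r) hδ
            field_simp; rfl
          · simp [Set.indicator, hf, hr2]
        · simp [Set.indicator, hr]
    _ = _ := by
        rw [← ENNReal.ofReal_mul (by positivity), ← ENNReal.ofReal_add (by positivity)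
          (by norm_num)]

/-- The larger of `s` and `t` is at least their mean, hence at least `δ`. The product of two poles
is thus dominated by single poles that are regularised at scale `δ`. -/
lemma one_div_mul_le_singularMajorant {δ s t : ℝ} (hs : 0 ≤ s) (ht : 0 ≤ t) (h : 2 * δ ≤ s + t)
    (hδ : 0 < δ) :
    1 / (s * t) ≤ singularMajorant δ s + singularMajorant δ t := by
  wlog hst : s ≤ t generalizing s t
  · rw [mul_comm, add_comm]; exact this ht hs (by linarith) (by linarith)
  refine le_add_of_le_of_nonneg ?_ (singularMajorant_nonneg ht)
  rcases hs.eq_or_lt with rfl | hs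
  · simp [singularMajorant]
  have := lt_max_of_lt_right (b := s) hδ
  unfold singularMajorant
  gcongr
  exact max_le hst (by linarith)

lemma one_div_le_one_add_singularMajorant {δ s : ℝ} (hs : 0 ≤ s) (hδ : 0 < δ) (hδ' : δ ≤ 1) :
    1 / s ≤ 1 + singularMajorant δ s := by
  rcases hs.eq_or_lt with rfl | hs
  · simp [singularMajorant]
  have h := lt_max_of_lt_right (b := s) hδ
  rcases le_or_gt s 1 with h1 | h1
  · refine le_add_of_nonneg_of_le zero_le_one ?_
    unfold singularMajorant
    gcongr
    have := max_le h1 hδ'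
    nlinarith
  · refine le_add_of_le_of_nonneg ?_ (singularMajorant_nonneg hs.le)
    rw [div_le_one hs]; exact h1.le

lemma logNeg_nonneg (z : ℝ) : 0 ≤ logNeg z := by
  unfold logNeg; simp

lemma neg_log_le_logNeg (z : ℝ) : -log z ≤ logNeg z := by
  unfold logNeg; simp

lemma one_add_norm_le {x q : Plane} (hq : q ∈ unitSquare 0) : 1 + ‖x‖ ≤ 3 * (1 + ‖x - q‖) := by
  have h1 := norm_le_of_mem_unitSquare_zero hq
  have h2 := norm_add_le (x - q) q
  rw [sub_add_cancel] at h2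
  have := norm_nonneg (x - q)
  linarith

/-- The two poles are separated at half their distance. The decay costs nothing extra: on the square
`1 + |x|` is comparable with `1 + |x-q|`, and expanding `(1+s)(1+t)/(st)` leaves only terms already
controlled. -/
lemma lintegral_kernel_product_le {x y : Plane} (hxy : x ≠ y) :
    ∫⁻ q in unitSquare 0, ENNReal.ofReal (1 / (‖x - q‖ * ‖y - q‖)) ≤
      ENNReal.ofReal (720 * (1 + logNeg ‖x - y‖) / ((1 + ‖x‖) * (1 + ‖y‖))) := by
  have hD : 0 < ‖x - y‖ := norm_pos_iff.2 (sub_ne_zero.2 hxy)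
  -- The cap at `1` is what turns the final logarithm into `ln⁻`.
  set δ := min ‖x - y‖ 1 / 2 with hδd
  have hδ : 0 < δ := by positivity
  have hδ1 : δ ≤ 1 / 2 := by
    have := min_le_right ‖x - y‖ 1
    linarith
  have hδ2 : 2 * δ ≤ ‖x - y‖ := by
    have := min_le_left ‖x - y‖ 1
    linarith
  set c := 9 / ((1 + ‖x‖) * (1 + ‖y‖)) with hc
  have hc0 : 0 ≤ c := by positivity
  have hpt : ∀ q ∈ unitSquare 0, ENNReal.ofReal (1 / (‖x - q‖ * ‖y - q‖)) ≤
      ENNReal.ofReal c * (ENNReal.ofReal 3 +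
        (ENNReal.ofReal 2 * ENNReal.ofReal (singularMajorant δ ‖x - q‖) +
        ENNReal.ofReal 2 * ENNReal.ofReal (singularMajorant δ ‖y - q‖))) := by
    intro q hq
    have hX := norm_nonneg (x - q)
    have hY := norm_nonneg (y - q)
    have gX := singularMajorant_nonneg (δ := δ) hX
    have gY := singularMajorant_nonneg (δ := δ) hY
    rw [← ENNReal.ofReal_mul (by norm_num), ← ENNReal.ofReal_mul (by norm_num),
      ← ENNReal.ofReal_add (by positivity) (by positivity),
      ← ENNReal.ofReal_add (by positivity) (by positivity), ← ENNReal.ofReal_mul hc0]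
    apply ENNReal.ofReal_le_ofReal
    have h3 : 2 * δ ≤ ‖x - q‖ + ‖y - q‖ := by
      refine hδ2.trans ?_
      have := norm_sub_le (x - q) (y - q)
      simpa using this
    have e1 := one_div_mul_le_singularMajorant hX hY h3 hδ
    have e2 := one_div_le_one_add_singularMajorant hX hδ (by linarith)
    have e3 := one_div_le_one_add_singularMajorant hY hδ (by linarith)
    have hx := one_add_norm_le (x := x) hq
    have hy := one_add_norm_le (x := y) hq
    rw [hc, div_mul_eq_mul_div, le_div_iff₀ (by positivity)]
    -- At the poles the convention `1 / 0 = 0` makes the left side vanish.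
    rcases hX.eq_or_lt with h0 | hX
    · rw [show 1 / (‖x - q‖ * ‖y - q‖) = 0 by rw [← h0]; simp, zero_mul]; linarith
    rcases hY.eq_or_lt with h0 | hY
    · rw [show 1 / (‖x - q‖ * ‖y - q‖) = 0 by rw [← h0]; simp, zero_mul]; linarith
    calc 1 / (‖x - q‖ * ‖y - q‖) * ((1 + ‖x‖) * (1 + ‖y‖))
        ≤ 1 / (‖x - q‖ * ‖y - q‖) * ((3 * (1 + ‖x - q‖)) * (3 * (1 + ‖y - q‖))) := by gcongr
      _ = 9 * (1 / (‖x - q‖ * ‖y - q‖) + 1 / ‖x - q‖ + 1 / ‖y - q‖ + 1) := by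
        field_simp; ring
      _ ≤ _ := by linarith
  have hmeas : ∀ z : Plane, Measurable fun q : Plane =>
      ENNReal.ofReal (singularMajorant δ ‖z - q‖) := fun z =>
    ((measurable_singularMajorant δ).comp (by fun_prop)).ennreal_ofReal
  have hlog : 0 ≤ log (2 / δ) := log_nonneg (by rw [le_div_iff₀ hδ]; linarith)
  set J := 2 * π * (1 + log (2 / δ)) + 1 / 4 with hJ
  have hJ0 : 0 ≤ J := by positivity
  calc _ ≤ ∫⁻ q in unitSquare 0, ENNReal.ofReal c * (ENNReal.ofReal 3 +
        (ENNReal.ofReal 2 * ENNReal.ofReal (singularMajorant δ ‖x - q‖) +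
        ENNReal.ofReal 2 * ENNReal.ofReal (singularMajorant δ ‖y - q‖))) :=
        setLIntegral_mono' (measurableSet_unitSquare 0) hpt
    _ = ENNReal.ofReal c * (ENNReal.ofReal 3 +
        (ENNReal.ofReal 2 * (∫⁻ q in unitSquare 0, ENNReal.ofReal (singularMajorant δ ‖x - q‖)) +
        ENNReal.ofReal 2 * ∫⁻ q in unitSquare 0, ENNReal.ofReal (singularMajorant δ ‖y - q‖))) := by
        rw [lintegral_const_mul _ (by fun_prop), lintegral_add_left measurable_const,
          lintegral_add_left (by fun_prop), lintegral_const_mul _ (by fun_prop),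
          lintegral_const_mul _ (by fun_prop)]
        simp [volume_unitSquare]
    _ ≤ ENNReal.ofReal c * (ENNReal.ofReal 3 +
        (ENNReal.ofReal 2 * ENNReal.ofReal J + ENNReal.ofReal 2 * ENNReal.ofReal J)) := by
        gcongr <;> exact lintegral_singularMajorant_unitSquare_le hδ (by linarith) _
    _ = ENNReal.ofReal (c * (3 + (2 * J + 2 * J))) := by
        rw [← ENNReal.ofReal_mul (by norm_num), ← ENNReal.ofReal_add (by positivity) (by positivity),
          ← ENNReal.ofReal_add (by positivity) (by positivity), ← ENNReal.ofReal_mul hc0]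
    _ ≤ _ := by
        apply ENNReal.ofReal_le_ofReal
        have hlogle : log (2 / δ) ≤ 3 / 2 + logNeg ‖x - y‖ := by
          have h4 : log 4 ≤ 3 / 2 := by
            have : log 4 = 2 * log 2 := by
              rw [show (4 : ℝ) = 2 ^ 2 by norm_num, log_pow]; norm_num
            have := log_two_lt_d9
            linarith
          have : log (2 / δ) = log 4 - log (min ‖x - y‖ 1) := by
            rw [← log_div (by norm_num) (by positivity), hδd]
            congr 1
            field_simp
            norm_num
          rw [this]
          have : - log (min ‖x - y‖ 1) ≤ logNeg ‖x - y‖ := by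
            rcases min_choice ‖x - y‖ 1 with h | h <;> rw [h]
            · exact neg_log_le_logNeg _
            · simpa using logNeg_nonneg _
          linarith
        have hln := logNeg_nonneg ‖x - y‖
        have hπ := pi_lt_d2
        have hπ0 := pi_pos
        rw [hc, div_mul_eq_mul_div]
        gcongr ?_ / _
        have : 2 * π * (1 + log (2 / δ)) ≤ 6.3 * (5 / 2 + logNeg ‖x - y‖) := by
          have := add_le_add_right hlogle 1
          gcongr ?_ * ?_ <;> linarith
        rw [hJ]
        linarith

end

section

/-! ### The velocity of the unit vortex patch -/

lemma lintegral_norm_biotSavart_le (x : Plane) :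
    ∫⁻ q in unitSquare 0, ‖biotSavart (x - q)‖ₑ ≤ ENNReal.ofReal 12 := by
  have hpt : ∀ q : Plane, ‖biotSavart (x - q)‖ₑ ≤
      ENNReal.ofReal 1 + ENNReal.ofReal (singularMajorant 1 ‖x - q‖) := by
    intro q
    have h := one_div_le_one_add_singularMajorant (norm_nonneg (x - q)) one_pos le_rfl
    rw [← ofReal_norm, norm_biotSavart, ← ENNReal.ofReal_add zero_le_one
      (singularMajorant_nonneg (norm_nonneg _))]
    apply ENNReal.ofReal_le_ofReal
    refine le_trans ?_ h
    rcases (norm_nonneg (x - q)).eq_or_lt with h0 | h0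
    · simp [← h0]
    · gcongr
      have := pi_gt_three
      nlinarith
  have hlog : log 2 ≤ 7 / 10 := by have := log_two_lt_d9; linarith
  have hlog0 : 0 ≤ log 2 := log_nonneg (by norm_num)
  calc _ ≤ ∫⁻ q in unitSquare 0,
        (ENNReal.ofReal 1 + ENNReal.ofReal (singularMajorant 1 ‖x - q‖)) := lintegral_mono hpt
    _ ≤ ENNReal.ofReal 1 + ENNReal.ofReal (2 * π * (1 + log (2 / 1)) + 1 / 4) := by
        rw [lintegral_add_left measurable_const]
        gcongr
        · simp [volume_unitSquare]
        · exact lintegral_singularMajorant_unitSquare_le one_pos (by norm_num) x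
    _ ≤ _ := by
        rw [div_one, ← ENNReal.ofReal_add (by norm_num) (by positivity)]
        apply ENNReal.ofReal_le_ofReal
        have := pi_lt_d2
        have : 2 * π * (1 + log 2) ≤ 6.3 * 1.7 := by gcongr <;> linarith
        linarith

lemma integrableOn_biotSavart (x : Plane) :
    IntegrableOn (fun q => biotSavart (x - q)) (unitSquare 0) :=
  ⟨(measurable_biotSavart.comp (by fun_prop)).aestronglyMeasurable,
    (lintegral_norm_biotSavart_le x).trans_lt ENNReal.ofReal_lt_top⟩

lemma norm_patchVelocity_sub_le (x y : Plane) :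
    ‖patchVelocity x - patchVelocity y‖ ≤
      120 * (‖x - y‖ * (1 + logNeg ‖x - y‖) / ((1 + ‖x‖) * (1 + ‖y‖))) := by
  rcases eq_or_ne x y with rfl | hxy
  · simp
  have hln := logNeg_nonneg ‖x - y‖
  unfold patchVelocity
  rw [← integral_sub (integrableOn_biotSavart x) (integrableOn_biotSavart y),
    ← ENNReal.ofReal_le_ofReal_iff (by positivity), ofReal_norm]
  refine (enorm_integral_le_lintegral_enorm _).trans ?_
  have hae : ∀ᵐ q ∂(volume.restrict (unitSquare 0) : Measure Plane),
      ‖biotSavart (x - q) - biotSavart (y - q)‖ₑ =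
        ENNReal.ofReal (‖x - y‖ / (2 * π)) * ENNReal.ofReal (1 / (‖x - q‖ * ‖y - q‖)) := by
    apply ae_restrict_of_ae
    have hx : ∀ᵐ q : Plane, q ≠ x := Measure.ae_ne volume x
    have hy : ∀ᵐ q : Plane, q ≠ y := Measure.ae_ne volume y
    filter_upwards [hx, hy] with q hqx hqy
    rw [← ofReal_norm, norm_biotSavart_sub (sub_ne_zero.2 hqx.symm) (sub_ne_zero.2 hqy.symm),
      ENNReal.ofReal_mul (by positivity)]
    simp
  rw [lintegral_congr_ae hae, lintegral_const_mul _ (by fun_prop)]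
  refine (mul_le_mul_right (lintegral_kernel_product_le hxy) _).trans ?_
  rw [← ENNReal.ofReal_mul (by positivity)]
  apply ENNReal.ofReal_le_ofReal
  -- The constant `120` is `720 / 6`, from `π > 3`.
  have hπ : 720 / (2 * π) ≤ 120 := by
    rw [div_le_iff₀ (by positivity)]
    have := pi_gt_three
    linarith
  calc _ = 720 / (2 * π) * (‖x - y‖ * (1 + logNeg ‖x - y‖) / ((1 + ‖x‖) * (1 + ‖y‖))) := by
        field_simp
    _ ≤ _ := by gcongr

lemma measurable_patchVelocity : Measurable patchVelocity := by
  have : StronglyMeasurable fun p : Plane × Plane => biotSavart (p.1 - p.2) :=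
    (measurable_biotSavart.comp (by fun_prop)).stronglyMeasurable
  exact this.integral_prod_right'.measurable

lemma measurable_renormalizedPatch (n : Lattice) : Measurable (renormalizedPatch n) :=
  (measurable_patchVelocity.comp (by fun_prop)).sub_const _

lemma norm_renormalizedPatch_sub_le (n : Lattice) (x y : Plane) :
    ‖renormalizedPatch n x - renormalizedPatch n y‖ ≤
      120 * (‖x - y‖ * (1 + logNeg ‖x - y‖)) *
        (1 / ((1 + ‖x - latticePoint n‖) * (1 + ‖y - latticePoint n‖))) := by
  have := norm_patchVelocity_sub_le (x - latticePoint n) (y - latticePoint n)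
  rw [sub_sub_sub_cancel_right] at this
  unfold renormalizedPatch
  rw [sub_sub_sub_cancel_right]
  exact this.trans_eq (by ring)

lemma renormalizedPatch_zero (n : Lattice) : renormalizedPatch n 0 = 0 := by
  simp [renormalizedPatch]

/-! ### Lattice sums -/

/-- The sup norm on the lattice, as a natural number. -/
def latticeNorm (m : Lattice) : ℕ := max (m 0).natAbs (m 1).natAbs

/-- The lower left corner of the unit square containing a point. -/
def floorPoint (x : Plane) : Lattice := fun i => ⌊x i⌋

/-- The shell of radius `k` for the sup norm has `8k` points when `k > 0` and one point when `k =
0`; the `+ 1` covers both cases. -/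
lemma card_filter_latticeNorm_le (s : Finset Lattice) (k : ℕ) :
    ((s.filter fun m => latticeNorm m = k).card : ℝ) ≤ 8 * (k + 1) := by
  have h : (s.filter fun m => latticeNorm m = k).card ≤ (Finset.box k : Finset (ℤ × ℤ)).card := by
    apply Finset.card_le_card_of_injOn (finTwoArrowEquiv ℤ)
    · intro m hm
      simp only [Finset.coe_filter, Set.mem_ofPred_eq] at hm
      simpa [Int.mem_box, finTwoArrowEquiv, latticeNorm] using hm.2
    · exact (finTwoArrowEquiv ℤ).injective.injOn
  have h2 : (Finset.box k : Finset (ℤ × ℤ)).card ≤ 8 * (k + 1) := by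
    rcases Nat.eq_zero_or_pos k with rfl | hk
    · simp
    · rw [Int.card_box hk.ne']; omega
  exact_mod_cast h.trans h2

lemma sum_latticeNorm_le (s : Finset Lattice) {f : ℕ → ℝ} (hf : ∀ k, 0 ≤ f k) {B : ℝ}
    (hB : ∀ N, ∑ k ∈ Finset.range N, 8 * (k + 1) * f k ≤ B) :
    ∑ m ∈ s, f (latticeNorm m) ≤ B := by
  obtain ⟨N, hN⟩ : ∃ N, ∀ m ∈ s, latticeNorm m < N :=
    ⟨s.sup latticeNorm + 1, fun m hm => Nat.lt_succ_of_le (Finset.le_sup hm)⟩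
  refine le_trans ?_ (hB N)
  rw [← Finset.sum_fiberwise_of_maps_to (t := Finset.range N) (g := latticeNorm)
    (fun m hm => Finset.mem_range.2 (hN m hm))]
  apply Finset.sum_le_sum
  intro k _
  rw [Finset.sum_congr rfl (g := fun _ => f k) fun m hm => by rw [(Finset.mem_filter.1 hm).2],
    Finset.sum_const, nsmul_eq_mul]
  gcongr
  · exact hf k
  · exact card_filter_latticeNorm_le s k

/-- Recentring at the corner of the square containing `x` lets lattice sums about an arbitrary point
be counted over shells about the origin. -/
lemma one_add_latticeNorm_le (x : Plane) (n : Lattice) :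
    (1 : ℝ) + latticeNorm (n - floorPoint x) ≤ 2 * (1 + ‖x - latticePoint n‖) := by
  have h : ∀ i, |((n i - ⌊x i⌋ : ℤ) : ℝ)| ≤ 1 + ‖x - latticePoint n‖ := by
    intro i
    have h1 : |x i - n i| ≤ ‖x - latticePoint n‖ := by
      simpa [latticePoint] using PiLp.norm_apply_le (x - latticePoint n) i
    have h2 := Int.floor_le (x i)
    have h3 := Int.lt_floor_add_one (x i)
    rw [abs_le] at h1 ⊢
    push_cast
    constructor <;> linarith [h1.1, h1.2]
  have : (latticeNorm (n - floorPoint x) : ℝ) ≤ 1 + ‖x - latticePoint n‖ := by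
    unfold latticeNorm floorPoint
    push_cast
    rw [Nat.cast_natAbs, Nat.cast_natAbs]
    push_cast
    simp only [Pi.sub_apply, Int.cast_sub]
    have h0 := h 0
    have h1 := h 1
    push_cast at h0 h1
    exact max_le h0 h1
  have := norm_nonneg (x - latticePoint n)
  linarith

/-- Cut at `⌊L⌋`: below, a harmonic sum is at most `1 + log L`; above, `L` times a tail of `∑ 1/k²`
is at most `2`. -/
lemma sum_range_inv_mul_min_le {L : ℝ} (hL : 1 ≤ L) (N : ℕ) :
    ∑ k ∈ Finset.range N, 1 / ((k : ℝ) + 1) * min 1 (L / (k + 1)) ≤ 4 + log L := by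
  set K := ⌊L⌋₊ with hK
  have hK1 : 1 ≤ K := Nat.one_le_floor_iff _ |>.2 hL
  have hKL : (K : ℝ) ≤ L := Nat.floor_le (by linarith)
  have hLK : L < K + 1 := Nat.lt_floor_add_one L
  have hnn : ∀ k : ℕ, 0 ≤ 1 / ((k : ℝ) + 1) * min 1 (L / (k + 1)) := fun k => by positivity
  calc _ ≤ ∑ k ∈ Finset.range (K + N), 1 / ((k : ℝ) + 1) * min 1 (L / (k + 1)) :=
        Finset.sum_le_sum_of_subset_of_nonneg (by intro k; simp; omega) fun k _ _ => hnn k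
    _ = ∑ k ∈ Finset.range K, 1 / ((k : ℝ) + 1) * min 1 (L / (k + 1)) +
        ∑ k ∈ Finset.range N, 1 / (((K + k : ℕ) : ℝ) + 1) * min 1 (L / ((K + k : ℕ) + 1)) :=
        Finset.sum_range_add _ _ _
    _ ≤ (1 + log L) + L * (2 / (K + 1)) := by
        gcongr ?_ + ?_
        · calc _ ≤ ∑ k ∈ Finset.range K, 1 / ((k : ℝ) + 1) := by
                apply Finset.sum_le_sum
                intro k _
                exact mul_le_of_le_one_right (by positivity) (min_le_left _ _)
            _ = ((harmonic K : ℚ) : ℝ) := by simp [harmonic]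
            _ ≤ 1 + log K := harmonic_le_one_add_log K
            _ ≤ 1 + log L := by gcongr
        · calc _ ≤ ∑ k ∈ Finset.range N, L * ((((K + k + 1 : ℕ) : ℝ)) ^ 2)⁻¹ := by
                apply Finset.sum_le_sum
                intro k _
                calc _ ≤ 1 / (((K + k : ℕ) : ℝ) + 1) * (L / ((K + k : ℕ) + 1)) := by
                      gcongr; exact min_le_right _ _
                  _ = _ := by push_cast; field_simp
            _ = L * ∑ i ∈ Finset.Ioo K (K + N + 1), ((i : ℝ) ^ 2)⁻¹ := by
                rw [Finset.mul_sum]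
                have : Finset.Ioo K (K + N + 1) = Finset.Ico (K + 1) (K + 1 + N) := by
                  ext; simp; omega
                rw [this, Finset.sum_Ico_eq_sum_range]
                simp only [Nat.add_sub_cancel_left]
                refine Finset.sum_congr rfl fun k _ => ?_
                rw [show K + k + 1 = K + 1 + k by ring]
            _ ≤ _ := by
                gcongr
                exact sum_Ioo_inv_sq_le K (K + N + 1)
    _ ≤ _ := by
        have : L * (2 / (K + 1)) ≤ 2 := by
          rw [mul_div_assoc', div_le_iff₀ (by positivity)]; linarith
        linarith

/-- The dominated half of the lattice sum, where `n` is closer to `x` than to `y`. -/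
lemma sum_lattice_min_le (s : Finset Lattice) (x : Plane) {L : ℝ} (hL : 1 ≤ L) :
    ∑ n ∈ s, 1 / (1 + ‖x - latticePoint n‖) ^ 2 * min 1 (L / (1 + ‖x - latticePoint n‖)) ≤
      64 * (4 + log L) := by
  set f : ℕ → ℝ := fun k => 8 * (1 / ((k : ℝ) + 1) ^ 2 * min 1 (L / (k + 1))) with hf
  have hf0 : ∀ k, 0 ≤ f k := fun k => by positivity
  calc _ ≤ ∑ n ∈ s, f (latticeNorm (n - floorPoint x)) := by
        apply Finset.sum_le_sum
        intro n _
        have h := one_add_latticeNorm_le x n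
        set k : ℝ := ((latticeNorm (n - floorPoint x) : ℕ) : ℝ) with hk
        set t := 1 + ‖x - latticePoint n‖ with ht
        have ht0 : 0 < t := by positivity
        have hk0 : 0 < k + 1 := by positivity
        have h1 : 1 / t ≤ 2 * (1 / (k + 1)) := by
          rw [mul_one_div, div_le_div_iff₀ ht0 hk0]; linarith
        have h2 : 1 / t ^ 2 ≤ 4 * (1 / (k + 1) ^ 2) := by
          calc 1 / t ^ 2 = (1 / t) ^ 2 := by simp
            _ ≤ (2 * (1 / (k + 1))) ^ 2 := by gcongr
            _ = _ := by field_simp; norm_num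
        have h3 : min 1 (L / t) ≤ 2 * min 1 (L / (k + 1)) := by
          rw [mul_min_of_nonneg _ _ (by norm_num)]
          apply min_le_min (by norm_num)
          calc L / t = L * (1 / t) := by ring
            _ ≤ L * (2 * (1 / (k + 1))) := by gcongr
            _ = _ := by ring
        calc _ ≤ 4 * (1 / (k + 1) ^ 2) * (2 * min 1 (L / (k + 1))) := by gcongr
          _ = _ := by simp only [hf]; ring
    _ = ∑ m ∈ s.map (Equiv.subRight (floorPoint x)).toEmbedding, f (latticeNorm m) := by
        rw [Finset.sum_map]; rfl
    _ ≤ _ := by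
        apply sum_latticeNorm_le _ hf0
        intro N
        calc _ = 64 * ∑ k ∈ Finset.range N, 1 / ((k : ℝ) + 1) * min 1 (L / (k + 1)) := by
              rw [Finset.mul_sum]
              refine Finset.sum_congr rfl fun k _ => ?_
              simp only [hf]
              field_simp
              norm_num
          _ ≤ _ := by gcongr; exact sum_range_inv_mul_min_le hL N

/-- The logarithmic bound for the lattice sums of the squared increments of the kernel. -/
lemma sum_lattice_le (s : Finset Lattice) (x y : Plane) :
    ∑ n ∈ s, (1 / ((1 + ‖x - latticePoint n‖) * (1 + ‖y - latticePoint n‖))) ^ 2 ≤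
      2560 * log (exp 1 + ‖x‖ + ‖y‖) / (1 + ‖x - y‖) ^ 2 := by
  set D := ‖x - y‖ with hD
  have hD0 : 0 ≤ D := norm_nonneg _
  have hL : 1 ≤ 1 + D := by linarith
  -- With `b` the larger distance, `D ≤ 2b`, so the ratio `(1+D)/(1+b)` is at most `2` and also at
  -- most `(1+D)/(1+a)`. The second bound cuts off the otherwise divergent sum at distances beyond
  -- `D`.
  have key : ∀ a b : ℝ, 0 ≤ a → 0 ≤ b → D ≤ a + b → a ≤ b →
      (1 + D) ^ 2 * (1 / ((1 + a) * (1 + b))) ^ 2 ≤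
        4 * (1 / (1 + a) ^ 2 * min 1 ((1 + D) / (1 + a))) := by
    intro a b ha hb hab hle
    have h1 : (1 + D) / (1 + b) ≤ 2 := by rw [div_le_iff₀ (by positivity)]; linarith
    have h2 : (1 + D) / (1 + b) ≤ (1 + D) / (1 + a) := by gcongr
    have h0 : 0 ≤ (1 + D) / (1 + b) := by positivity
    have h3 : ((1 + D) / (1 + b)) ^ 2 ≤ 4 * min 1 ((1 + D) / (1 + a)) := by
      rw [mul_min_of_nonneg _ _ (by norm_num)]
      apply le_min <;> nlinarith
    calc _ = 1 / (1 + a) ^ 2 * ((1 + D) / (1 + b)) ^ 2 := by field_simp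
      _ ≤ 1 / (1 + a) ^ 2 * (4 * min 1 ((1 + D) / (1 + a))) := by gcongr
      _ = _ := by ring
  rw [le_div_iff₀ (by positivity), mul_comm, Finset.mul_sum]
  have hlog : log (1 + D) ≤ log (exp 1 + ‖x‖ + ‖y‖) := by
    have := norm_sub_le x y
    have := add_one_le_exp (1 : ℝ)
    apply log_le_log (by positivity)
    linarith
  have hlog1 : 1 ≤ log (exp 1 + ‖x‖ + ‖y‖) := by
    rw [le_log_iff_exp_le (by positivity)]
    have := norm_nonneg x
    have := norm_nonneg y
    linarith
  calc _ ≤ ∑ n ∈ s,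
        (4 * (1 / (1 + ‖x - latticePoint n‖) ^ 2 *
          min 1 ((1 + D) / (1 + ‖x - latticePoint n‖))) +
        4 * (1 / (1 + ‖y - latticePoint n‖) ^ 2 *
          min 1 ((1 + D) / (1 + ‖y - latticePoint n‖)))) := by
        apply Finset.sum_le_sum
        intro n _
        have ha := norm_nonneg (x - latticePoint n)
        have hb := norm_nonneg (y - latticePoint n)
        have hab : D ≤ ‖x - latticePoint n‖ + ‖y - latticePoint n‖ := by
          have := norm_sub_le (x - latticePoint n) (y - latticePoint n)
          rwa [sub_sub_sub_cancel_right] at this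
        rcases le_total ‖x - latticePoint n‖ ‖y - latticePoint n‖ with h | h
        · exact (key _ _ ha hb hab h).trans (le_add_of_nonneg_right (by positivity))
        · have := key _ _ hb ha (by linarith) h
          rw [mul_comm (1 + ‖x - latticePoint n‖)]
          exact this.trans (le_add_of_nonneg_left (by positivity))
    _ ≤ 4 * (64 * (4 + log (1 + D))) + 4 * (64 * (4 + log (1 + D))) := by
        rw [Finset.sum_add_distrib, ← Finset.mul_sum, ← Finset.mul_sum]
        gcongr <;> exact sum_lattice_min_le s _ hL
    -- Since the logarithm is at least `1`, `512 (4 + log) ≤ 2560 log`.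
    _ ≤ _ := by linarith

lemma summable_latticeWeight :
    Summable fun n : Lattice => (1 / (1 + ‖latticePoint n‖) ^ 2) ^ 2 := by
  apply summable_of_sum_le (c := 2560) (fun n => by positivity)
  intro s
  have := sum_lattice_le s 0 0
  simpa [← sq] using this

end

section

open scoped Nat NNReal

/-! ### Moments of random sums -/

/-- From `|X|^k ≤ k! σ^k exp(|X|/σ)`: the two exponential moments at `±1/σ` are at most `e^{1/2} ≤
2` each, so `E|X|^k ≤ 4 k! σ^k`. The crude `4 k! ≤ (4 k!)^k` then avoids a `k`-th root. -/
lemma _root_.ProbabilityTheory.HasSubgaussianMGF.eLpNorm_le {Ω : Type*} [MeasurableSpace Ω]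
    {μ : Measure Ω} {X : Ω → ℝ} {c : ℝ≥0} (h : HasSubgaussianMGF X c μ) {σ : ℝ} (hσ : 0 ≤ σ)
    (hc : c ≤ σ ^ 2) {k : ℕ} (hk : k ≠ 0) :
    eLpNorm X k μ ≤ ENNReal.ofReal (4 * k ! * σ) := by
  rcases hσ.eq_or_lt with rfl | hσ
  · have : c = 0 := by
      have : (c : ℝ) ≤ 0 := by simpa using hc
      exact_mod_cast le_antisymm this c.2
    rw [this] at h
    rw [eLpNorm_congr_ae h.ae_eq_zero_of_hasSubgaussianMGF_zero]
    simp
  have hfact : (1 : ℝ) ≤ k ! := by exact_mod_cast Nat.one_le_iff_ne_zero.2 (Nat.factorial_ne_zero k)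
  have hint : ∀ t, Integrable (fun ω => exp (t * X ω)) μ := h.integrable_exp_mul
  have hexp : ∀ t, t ^ 2 = (1 / σ) ^ 2 → ∫ ω, exp (t * X ω) ∂μ ≤ 2 := by
    intro t ht
    refine (h.mgf_le t).trans ?_
    calc exp (c * t ^ 2 / 2) ≤ exp (σ ^ 2 * t ^ 2 / 2) := by gcongr
      _ = exp (1 / 2) := by rw [ht]; congr 1; field_simp
      _ ≤ 2 := by
        have := log_two_gt_d9
        rw [← le_log_iff_exp_le (by norm_num)]
        linarith
  have hpt : ∀ ω, |X ω| ^ k ≤ k ! * σ ^ k * (exp (1 / σ * X ω) + exp (-(1 / σ) * X ω)) := by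
    intro ω
    have h1 := pow_div_factorial_le_exp (x := |X ω| / σ) (by positivity) k
    rw [div_le_iff₀ (by positivity), div_pow, div_le_iff₀ (by positivity)] at h1
    have h2 : exp (|X ω| / σ) ≤ exp (1 / σ * X ω) + exp (-(1 / σ) * X ω) := by
      rcases abs_choice (X ω) with h | h <;> rw [h]
      · rw [div_eq_mul_one_div, mul_comm]; exact le_add_of_nonneg_right (exp_pos _).le
      · rw [div_eq_mul_one_div, mul_comm, mul_neg, ← neg_mul]
        exact le_add_of_nonneg_left (exp_pos _).le
    calc _ ≤ exp (|X ω| / σ) * k ! * σ ^ k := h1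
      _ = k ! * σ ^ k * exp (|X ω| / σ) := by ring
      _ ≤ _ := by gcongr
  have hk0 : (0 : ℝ) < k := by positivity
  rw [eLpNorm_eq_lintegral_rpow_enorm_toReal (by simpa using hk) (by simp)]
  simp only [ENNReal.toReal_natCast, ENNReal.rpow_natCast]
  rw [one_div, ENNReal.rpow_inv_le_iff hk0, ENNReal.rpow_natCast, 
    ← ENNReal.ofReal_pow (mul_nonneg (by linarith) hσ.le : 0 ≤ 4 * (k ! : ℝ) * σ)]
  calc ∫⁻ ω, ‖X ω‖ₑ ^ k ∂μ
      ≤ ∫⁻ ω, ENNReal.ofReal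
          (k ! * σ ^ k * (exp (1 / σ * X ω) + exp (-(1 / σ) * X ω))) ∂μ := by
        apply lintegral_mono
        intro ω
        dsimp only
        rw [← ofReal_norm, norm_eq_abs, ← ENNReal.ofReal_pow (abs_nonneg _)]
        exact ENNReal.ofReal_le_ofReal (hpt ω)
    _ = ENNReal.ofReal (∫ ω, k ! * σ ^ k * (exp (1 / σ * X ω) + exp (-(1 / σ) * X ω)) ∂μ) :=
        (ofReal_integral_eq_lintegral_ofReal (((hint _).add (hint _)).const_mul _)
          (ae_of_all _ fun ω => (pow_nonneg (abs_nonneg _) k).trans (hpt ω))).symm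
    _ ≤ ENNReal.ofReal ((4 * k ! * σ) ^ k) := by
        apply ENNReal.ofReal_le_ofReal
        rw [integral_const_mul, integral_add (hint _) (hint _)]
        calc _ ≤ k ! * σ ^ k * (2 + 2) := by
              gcongr
              · exact hexp _ rfl
              · exact hexp _ (by ring)
          _ = (4 * k !) * σ ^ k := by ring
          _ ≤ (4 * k !) ^ k * σ ^ k := by
              gcongr
              exact le_self_pow₀ (by linarith) hk
          _ = _ := (mul_pow _ _ _).symm

variable {Ω : Type*} [MeasurableSpace Ω] {μ : Measure Ω} [IsProbabilityMeasure μ]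
  {a : Lattice → Ω → ℝ} {M : ℝ}

/-- By Hoeffding's lemma a centred variable in `[-M, M]` is subgaussian with proxy `M²`, and proxies
of independent variables add. -/
lemma eLpNorm_real_sum_le (ha : ∀ n, Measurable (a n)) (hind : iIndepFun a μ)
    (hM : ∀ n, ∀ᵐ ω ∂μ, |a n ω| ≤ M) (h0 : ∀ n, ∫ ω, a n ω ∂μ = 0)
    (s : Finset Lattice) (c : Lattice → ℝ) {k : ℕ} (hk : k ≠ 0) {σ : ℝ} (hσ : 0 ≤ σ)
    (hc : ∑ n ∈ s, c n ^ 2 ≤ σ ^ 2) :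
    eLpNorm (fun ω => ∑ n ∈ s, a n ω * c n) k μ ≤ ENNReal.ofReal (4 * k ! * (|M| * σ)) := by
  have hsub : ∀ n, HasSubgaussianMGF (fun ω => c n * a n ω)
      (Real.toNNReal (c n ^ 2) * (‖M - -M‖₊ / 2) ^ 2) μ := fun n => by
    rw [Real.toNNReal_of_nonneg (sq_nonneg _)]
    exact (hasSubgaussianMGF_of_mem_Icc_of_integral_eq_zero (ha n).aemeasurable
      ((hM n).mono fun ω h => abs_le.1 h) (h0 n)).const_mul (c n)
  have hind' : iIndepFun (fun n ω => c n * a n ω) μ :=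
    hind.comp (fun n x => c n * x) fun n => measurable_const_mul _
  have hsum := HasSubgaussianMGF.sum_of_iIndepFun hind' (s := s) fun n _ => hsub n
  simp only [mul_comm (a _ _)]
  refine hsum.eLpNorm_le (by positivity) ?_ hk
  push_cast
  simp only [Real.coe_toNNReal _ (sq_nonneg _)]
  rw [← Finset.sum_mul]
  have : ((‖M - -M‖ / 2) ^ 2 : ℝ) = |M| ^ 2 := by
    rw [sub_neg_eq_add, ← two_mul, norm_mul]; simp
  rw [this, mul_pow, mul_comm]
  gcongr

lemma norm_le_abs_add_abs (z : Plane) : ‖z‖ ≤ |z 0| + |z 1| := by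
  rw [EuclideanSpace.norm_eq, sqrt_le_left (by positivity)]
  simp only [Fin.sum_univ_two, norm_eq_abs]
  nlinarith [abs_nonneg (z 0), abs_nonneg (z 1)]

lemma abs_apply_le_norm (z : Plane) (i : Fin 2) : |z i| ≤ ‖z‖ := PiLp.norm_apply_le z i

lemma eLpNorm_plane_le {α : Type*} [MeasurableSpace α] {ν : Measure α} {f : α → Plane}
    (hf : Measurable f) {p : ℝ≥0∞} (hp : 1 ≤ p) :
    eLpNorm f p ν ≤ eLpNorm (fun x => f x 0) p ν + eLpNorm (fun x => f x 1) p ν := by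
  have h : ∀ i, Measurable fun x => |f x i| := fun i =>
    ((by fun_prop : Measurable fun z : Plane => |z i|)).comp hf
  calc eLpNorm f p ν ≤ eLpNorm ((fun x => |f x 0|) + fun x => |f x 1|) p ν :=
        eLpNorm_mono_real fun x => norm_le_abs_add_abs (f x)
    _ ≤ eLpNorm (fun x => |f x 0|) p ν + eLpNorm (fun x => |f x 1|) p ν :=
        eLpNorm_add_le (h 0).aestronglyMeasurable (h 1).aestronglyMeasurable hp
    _ = _ := by
        congr 1 <;> exact eLpNorm_congr_norm_ae (ae_of_all _ fun x => by simp)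

/-- The constant in the moment bound for random sums. -/
def momentConst (M p : ℝ) : ℝ := 8 * (⌈p⌉₊)! * |M|

lemma momentConst_nonneg (M p : ℝ) : 0 ≤ momentConst M p := by
  unfold momentConst; positivity

/-- A Khinchine-type inequality for plane-valued coefficients: raise `p` to an integer exponent and
add the bounds for the two coordinates, which doubles the factor `4`. -/
lemma eLpNorm_sum_le (ha : ∀ n, Measurable (a n)) (hind : iIndepFun a μ)
    (hM : ∀ n, ∀ᵐ ω ∂μ, |a n ω| ≤ M) (h0 : ∀ n, ∫ ω, a n ω ∂μ = 0)
    (s : Finset Lattice) (c : Lattice → Plane) {p : ℝ} (hp : 1 ≤ p) {σ : ℝ} (hσ : 0 ≤ σ)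
    (hc : ∑ n ∈ s, ‖c n‖ ^ 2 ≤ σ ^ 2) :
    eLpNorm (fun ω => ∑ n ∈ s, a n ω • c n) (ENNReal.ofReal p) μ ≤
      ENNReal.ofReal (momentConst M p * σ) := by
  set k := ⌈p⌉₊ with hk
  have hk0 : k ≠ 0 := by
    have : 0 < k := Nat.ceil_pos.2 (by linarith)
    exact this.ne'
  have hpk : ENNReal.ofReal p ≤ (k : ℝ≥0∞) := by
    rw [← ENNReal.ofReal_natCast]
    exact ENNReal.ofReal_le_ofReal (Nat.le_ceil p)
  have hk1 : (1 : ℝ≥0∞) ≤ k := by exact_mod_cast Nat.one_le_iff_ne_zero.2 hk0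
  have hmeas : Measurable fun ω => ∑ n ∈ s, a n ω • c n :=
    Finset.measurable_sum _ fun n _ => (ha n).smul_const _
  have hcomp : ∀ i : Fin 2, ∑ n ∈ s, (c n i) ^ 2 ≤ σ ^ 2 := fun i =>
    (Finset.sum_le_sum fun n _ => sq_le_sq.2
      ((abs_apply_le_norm (c n) i).trans (le_abs_self _))).trans hc
  calc _ ≤ eLpNorm (fun ω => ∑ n ∈ s, a n ω • c n) k μ :=
        eLpNorm_le_eLpNorm_of_exponent_le hpk hmeas.aestronglyMeasurable
    _ ≤ _ := eLpNorm_plane_le hmeas hk1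
    _ ≤ ENNReal.ofReal (4 * k ! * (|M| * σ)) + ENNReal.ofReal (4 * k ! * (|M| * σ)) := by
        gcongr
        all_goals
          simp only [WithLp.ofLp_sum, WithLp.ofLp_smul, Finset.sum_apply, Pi.smul_apply,
            smul_eq_mul]
          exact eLpNorm_real_sum_le ha hind hM h0 s _ hk0 hσ (hcomp _)
    _ = _ := by
        rw [← ENNReal.ofReal_add (by positivity) (by positivity), momentConst]
        congr 1
        ring

end

section

/-! ### Pointwise bounds for the renormalized patches -/

lemma mul_one_add_logNeg_le {t : ℝ} (ht : 0 ≤ t) : t * (1 + logNeg t) ≤ 1 + t := by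
  rcases ht.eq_or_lt with rfl | ht
  · simp
  have : t * logNeg t ≤ 1 := by
    unfold logNeg
    rcases min_choice 0 (log t) with h | h <;> rw [h]
    · simp
    · have h1 := one_sub_inv_le_log_of_pos ht
      calc t * -log t ≤ t * (t⁻¹ - 1) := by gcongr; linarith
        _ = 1 - t := by field_simp
        _ ≤ 1 := by linarith
  linarith

/-- The square-summable weight `(1 + |n|)⁻²` that dominates `renormalizedPatch n` on bounded
sets. -/
def latticeWeight (n : Lattice) : ℝ := 1 / (1 + ‖latticePoint n‖) ^ 2

lemma latticeWeight_pos (n : Lattice) : 0 < latticeWeight n := by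
  unfold latticeWeight; positivity

/-- Comparison with the origin, where the renormalized patch vanishes. The inequality `1+|n| ≤
(1+|x|)(1+|x-n|)` separates the dependence on `n` from that on `x`. -/
lemma norm_renormalizedPatch_le (n : Lattice) (x : Plane) :
    ‖renormalizedPatch n x‖ ≤ 120 * (1 + ‖x‖) ^ 2 * latticeWeight n := by
  have h := norm_renormalizedPatch_sub_le n x 0
  rw [renormalizedPatch_zero, sub_zero, sub_zero, zero_sub, norm_neg] at h
  refine h.trans ?_
  have h1 := mul_one_add_logNeg_le (norm_nonneg x)
  have h2 : 1 / ((1 + ‖x - latticePoint n‖) * (1 + ‖latticePoint n‖)) ≤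
      (1 + ‖x‖) * latticeWeight n := by
    have h3 : 1 + ‖latticePoint n‖ ≤ (1 + ‖x‖) * (1 + ‖x - latticePoint n‖) := by
      have := norm_sub_le x (x - latticePoint n)
      rw [sub_sub_cancel] at this
      nlinarith [mul_nonneg (norm_nonneg x) (norm_nonneg (x - latticePoint n))]
    unfold latticeWeight
    rw [mul_one_div, div_le_div_iff₀ (by positivity) (by positivity)]
    have : 0 ≤ 1 + ‖latticePoint n‖ := by positivity
    nlinarith
  have := latticeWeight_pos n
  calc _ ≤ 120 * (1 + ‖x‖) * ((1 + ‖x‖) * latticeWeight n) := by gcongr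
    _ = _ := by ring

lemma sum_norm_renormalizedPatch_sub_le (s : Finset Lattice) (x y : Plane) :
    ∑ n ∈ s, ‖renormalizedPatch n x - renormalizedPatch n y‖ ^ 2 ≤
      (6120 * growthModulus x y) ^ 2 := by
  have hl : 0 ≤ log (exp 1 + ‖x‖ + ‖y‖) := by
    apply log_nonneg
    have := add_one_le_exp (1 : ℝ)
    have := norm_nonneg x
    have := norm_nonneg y
    linarith
  set A := ‖x - y‖ * (1 + logNeg ‖x - y‖) with hA
  calc _ ≤ ∑ n ∈ s, (120 * A) ^ 2 *
        (1 / ((1 + ‖x - latticePoint n‖) * (1 + ‖y - latticePoint n‖))) ^ 2 := by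
        apply Finset.sum_le_sum
        intro n _
        rw [← mul_pow]
        exact pow_le_pow_left₀ (norm_nonneg _) (norm_renormalizedPatch_sub_le n x y) 2
    _ ≤ (120 * A) ^ 2 * (2560 * log (exp 1 + ‖x‖ + ‖y‖) / (1 + ‖x - y‖) ^ 2) := by
        rw [← Finset.mul_sum]
        gcongr
        exact sum_lattice_le s x y
    _ = (120 ^ 2 * 2560) * (growthModulus x y) ^ 2 := by
        unfold growthModulus
        rw [← hA, mul_pow (A / _), sq_sqrt hl]
        field_simp
    -- `6120 = 120 · 51`, and `2560 ≤ 51²`.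
    _ ≤ _ := by nlinarith [sq_nonneg (growthModulus x y)]

lemma growthModulus_nonneg (x y : Plane) : 0 ≤ growthModulus x y := by
  unfold growthModulus
  have := logNeg_nonneg ‖x - y‖
  positivity

/-! ### Exhaustion of the lattice -/

lemma sum_latticeWeight_sq_le (s : Finset Lattice) : ∑ n ∈ s, latticeWeight n ^ 2 ≤ 51 ^ 2 := by
  have := sum_lattice_le s 0 0
  simp only [zero_sub, norm_neg, norm_zero, sub_zero, add_zero, log_exp, ← sq] at this
  unfold latticeWeight
  refine this.trans (by norm_num)

lemma exists_exhaustion : ∃ F : ℕ → Finset Lattice, Monotone F ∧ F 0 = ∅ ∧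
    ∀ k s, Disjoint s (F k) → ∑ n ∈ s, latticeWeight n ^ 2 ≤ (51 * (1 / 2) ^ k) ^ 2 := by
  have hsum : Summable fun n => latticeWeight n ^ 2 := summable_latticeWeight
  have : ∀ k : ℕ, ∃ s : Finset Lattice, ∀ t, Disjoint t s →
      ∑ n ∈ t, latticeWeight n ^ 2 ≤ (51 * (1 / 2) ^ k) ^ 2 := by
    intro k
    obtain ⟨s, hs⟩ := summable_iff_vanishing_norm.1 hsum ((51 * (1 / 2) ^ k) ^ 2) (by positivity)
    exact ⟨s, fun t ht => (le_norm_self _).trans (hs t ht).le⟩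
  choose s hs using this
  -- Unions over `Ioc 0 k` give monotonicity and an empty set at `k = 0`. The error bound at `k = 0`
  -- is then a bound for the field itself.
  refine ⟨fun k => (Finset.Ioc 0 k).biUnion s, ?_, by simp, ?_⟩
  · intro i j hij
    exact Finset.biUnion_subset_biUnion_of_subset_left _ (Finset.Ioc_subset_Ioc le_rfl hij)
  · intro k t ht
    rcases Nat.eq_zero_or_pos k with rfl | hk
    · simpa using sum_latticeWeight_sq_le t
    · exact hs k t (ht.mono_right (Finset.subset_biUnion_of_mem s (by simp; omega)))

/-- An increasing sequence of finite subsets of the lattice outside of which the weights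
`latticeWeight` are geometrically small in `ℓ²`. -/
def exhaustion : ℕ → Finset Lattice := exists_exhaustion.choose

lemma exhaustion_mono : Monotone exhaustion := exists_exhaustion.choose_spec.1

lemma exhaustion_zero : exhaustion 0 = ∅ := exists_exhaustion.choose_spec.2.1

lemma sum_latticeWeight_le {k : ℕ} {s : Finset Lattice} (h : Disjoint s (exhaustion k)) :
    ∑ n ∈ s, latticeWeight n ^ 2 ≤ (51 * (1 / 2) ^ k) ^ 2 :=
  exists_exhaustion.choose_spec.2.2 k s h

/-- All weights are positive, so a point that stayed outside would keep the tails bounded below. -/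
lemma eventually_mem_exhaustion (n : Lattice) : ∀ᶠ k in atTop, n ∈ exhaustion k := by
  have hlim : Tendsto (fun k : ℕ => (51 * (1 / 2 : ℝ) ^ k) ^ 2) atTop (𝓝 ((51 * 0) ^ 2)) :=
    ((tendsto_pow_atTop_nhds_zero_of_lt_one (by norm_num) (by norm_num)).const_mul 51).pow 2
  have hpos : ((51 * 0) ^ 2 : ℝ) < latticeWeight n ^ 2 := by
    have := latticeWeight_pos n
    simp; positivity
  filter_upwards [hlim.eventually_lt_const hpos] with k hk
  by_contra hn
  have := sum_latticeWeight_le (s := {n}) (k := k) (by simpa using hn)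
  simp only [Finset.sum_singleton] at this
  linarith

/-! ### The random velocity field -/

variable {Ω : Type*}

/-- The partial sums of the series for the random velocity field. -/
def partialField (a : Lattice → Ω → ℝ) (s : Finset Lattice) (ω : Ω) (x : Plane) : Plane :=
  ∑ n ∈ s, a n ω • renormalizedPatch n x

/-- The random velocity field. -/
def randomField (a : Lattice → Ω → ℝ) (ω : Ω) (x : Plane) : Plane :=
  -- A pointwise limit along a fixed sequence, rather than a class in `L²`, gives a jointly
  -- measurable field with a value at every point.
  limUnder atTop fun k => partialField a (exhaustion k) ω x

/-- The size of the error of the partial sums at a point. -/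
def errorConst (M : ℝ) (x : Plane) : ℝ := 2 * momentConst M 2 * (6120 * (1 + ‖x‖) ^ 2)

lemma errorConst_nonneg (M : ℝ) (x : Plane) : 0 ≤ errorConst M x := by
  have := momentConst_nonneg M 2
  unfold errorConst; positivity

variable [MeasurableSpace Ω] {μ : Measure Ω} {a : Lattice → Ω → ℝ} {M : ℝ}

lemma measurable_partialField (ha : ∀ n, Measurable (a n)) (s : Finset Lattice) :
    Measurable (Function.uncurry (partialField a s)) :=
  Finset.measurable_sum _ fun n _ => ((ha n).comp measurable_fst).smul
    ((measurable_renormalizedPatch n).comp measurable_snd)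

lemma measurable_randomField (ha : ∀ n, Measurable (a n)) :
    Measurable (Function.uncurry (randomField a)) :=
  (StronglyMeasurable.limUnder (l := atTop) fun k =>
    (measurable_partialField ha (exhaustion k)).stronglyMeasurable).measurable

variable [IsProbabilityMeasure μ]

lemma eLpNorm_partialField_sub_exhaustion_le (ha : ∀ n, Measurable (a n)) (hind : iIndepFun a μ)
    (hM : ∀ n, ∀ᵐ ω ∂μ, |a n ω| ≤ M) (h0 : ∀ n, ∫ ω, a n ω ∂μ = 0) (x : Plane) {k : ℕ}
    {s : Finset Lattice} (hs : exhaustion k ⊆ s) :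
    eLpNorm (fun ω => partialField a s ω x - partialField a (exhaustion k) ω x) 2 μ ≤
      ENNReal.ofReal (errorConst M x / 2 * (1 / 2) ^ k) := by
  have heq : (fun ω => partialField a s ω x - partialField a (exhaustion k) ω x) =
      fun ω => ∑ n ∈ s \ exhaustion k, a n ω • renormalizedPatch n x := by
    ext1 ω
    rw [sub_eq_iff_eq_add]
    exact (Finset.sum_sdiff hs).symm
  have h := eLpNorm_sum_le ha hind hM h0 (s \ exhaustion k) (fun n => renormalizedPatch n x)
    (p := 2) (by norm_num) (σ := 120 * (1 + ‖x‖) ^ 2 * (51 * (1 / 2) ^ k)) (by positivity) (by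
      rw [mul_pow (120 * (1 + ‖x‖) ^ 2)]
      refine le_trans ?_ (mul_le_mul_of_nonneg_left
        (sum_latticeWeight_le (Finset.sdiff_disjoint (s := exhaustion k) (t := s)))
        (by positivity))
      rw [Finset.mul_sum]
      apply Finset.sum_le_sum
      intro n _
      rw [← mul_pow]
      exact pow_le_pow_left₀ (norm_nonneg _) (norm_renormalizedPatch_le n x) 2)
  rw [heq]
  rw [show ENNReal.ofReal 2 = 2 by simp] at h
  refine h.trans_eq ?_
  congr 1
  unfold errorConst
  ring

lemma eLpNorm_partialField_sub_le (ha : ∀ n, Measurable (a n)) (hind : iIndepFun a μ)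
    (hM : ∀ n, ∀ᵐ ω ∂μ, |a n ω| ≤ M) (h0 : ∀ n, ∫ ω, a n ω ∂μ = 0) (x : Plane) {k : ℕ}
    {s t : Finset Lattice} (hs : exhaustion k ⊆ s) (ht : exhaustion k ⊆ t) :
    eLpNorm (fun ω => partialField a s ω x - partialField a t ω x) 2 μ ≤
      ENNReal.ofReal (errorConst M x * (1 / 2) ^ k) := by
  have hm : ∀ s, Measurable fun ω => partialField a s ω x := fun s =>
    (measurable_partialField ha s).comp measurable_prodMk_right
  have h1 := eLpNorm_partialField_sub_exhaustion_le ha hind hM h0 x hs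
  have h2 := eLpNorm_partialField_sub_exhaustion_le ha hind hM h0 x ht
  have h3 := eLpNorm_sub_le (p := 2) (μ := μ)
    ((hm s).sub (hm (exhaustion k))).aestronglyMeasurable
    ((hm t).sub (hm (exhaustion k))).aestronglyMeasurable (by norm_num)
  have heq : (fun ω => partialField a s ω x - partialField a t ω x) =
      ((fun ω => partialField a s ω x) - fun ω => partialField a (exhaustion k) ω x) -
      ((fun ω => partialField a t ω x) - fun ω => partialField a (exhaustion k) ω x) := by
    ext1 ω; simp
  rw [heq]
  refine (h3.trans (add_le_add h1 h2)).trans_eq ?_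
  have := errorConst_nonneg M x
  rw [← ENNReal.ofReal_add (by positivity) (by positivity)]
  congr 1
  ring

/-- The `L²(Ω)` errors along the exhaustion are geometric, hence summable, which forces almost sure
convergence at each fixed `x`. -/
lemma ae_tendsto_partialField (ha : ∀ n, Measurable (a n)) (hind : iIndepFun a μ)
    (hM : ∀ n, ∀ᵐ ω ∂μ, |a n ω| ≤ M) (h0 : ∀ n, ∫ ω, a n ω ∂μ = 0) (x : Plane) :
    ∀ᵐ ω ∂μ, Tendsto (fun k => partialField a (exhaustion k) ω x) atTop
      (𝓝 (randomField a ω x)) := by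
  have hm : ∀ s, Measurable fun ω => partialField a s ω x := fun s =>
    (measurable_partialField ha s).comp measurable_prodMk_right
  have hB := errorConst_nonneg M x
  have hsum : Summable fun k : ℕ => (errorConst M x + 1) * (1 / 2 : ℝ) ^ k :=
    (summable_geometric_of_lt_one (by norm_num) (by norm_num)).mul_left _
  have h := Lp.ae_tendsto_of_cauchy_eLpNorm (μ := μ) (p := 2)
    (f := fun k ω => partialField a (exhaustion k) ω x)
    (fun k => (hm _).aestronglyMeasurable) (by norm_num)
    -- The `+ 1` makes the Cauchy bound strict even if the error constant is `0`.
    (B := fun k => ENNReal.ofReal ((errorConst M x + 1) * (1 / 2 : ℝ) ^ k))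
    (by
      rw [← ENNReal.ofReal_tsum_of_nonneg (fun k => by positivity) hsum]
      exact ENNReal.ofReal_ne_top)
    (fun N i j hi hj => by
      refine (eLpNorm_partialField_sub_le ha hind hM h0 x (exhaustion_mono hi)
        (exhaustion_mono hj)).trans_lt ?_
      apply (ENNReal.ofReal_lt_ofReal_iff (by positivity)).2
      gcongr
      linarith)
  filter_upwards [h] with ω hω
  exact tendsto_nhds_limUnder hω

lemma liminf_le_of_forall_le {f : ℕ → ℝ≥0∞} {b : ℝ≥0∞} (h : ∀ᶠ k in atTop, f k ≤ b) :
    liminf f atTop ≤ b :=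
  (liminf_le_liminf h).trans (liminf_const b).le

lemma eLpNorm_randomField_sub_partialField_le (ha : ∀ n, Measurable (a n)) (hind : iIndepFun a μ)
    (hM : ∀ n, ∀ᵐ ω ∂μ, |a n ω| ≤ M) (h0 : ∀ n, ∫ ω, a n ω ∂μ = 0) (x : Plane) {k : ℕ}
    {s : Finset Lattice} (hs : exhaustion k ⊆ s) :
    eLpNorm (fun ω => randomField a ω x - partialField a s ω x) 2 μ ≤
      ENNReal.ofReal (errorConst M x * (1 / 2) ^ k) := by
  have hm : ∀ s, Measurable fun ω => partialField a s ω x := fun s =>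
    (measurable_partialField ha s).comp measurable_prodMk_right
  refine (Lp.eLpNorm_lim_le_liminf_eLpNorm
    (f := fun j ω => partialField a (exhaustion j) ω x - partialField a s ω x)
    (fun j => ((hm _).sub (hm _)).aestronglyMeasurable) _ ?_).trans (liminf_le_of_forall_le ?_)
  · filter_upwards [ae_tendsto_partialField ha hind hM h0 x] with ω hω
    exact hω.sub_const _
  · filter_upwards [eventually_ge_atTop k] with j hj
    exact eLpNorm_partialField_sub_le ha hind hM h0 x (exhaustion_mono hj) hs

/-- The moment bound is uniform over the partial sums, so Fatou's lemma passes it to the limit for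
every `p`. -/
lemma incrementBound_randomField (ha : ∀ n, Measurable (a n)) (hind : iIndepFun a μ)
    (hM : ∀ n, ∀ᵐ ω ∂μ, |a n ω| ≤ M) (h0 : ∀ n, ∫ ω, a n ω ∂μ = 0) {p : ℝ} (hp : 1 ≤ p) :
    IncrementBound μ (randomField a) p (momentConst M p * 6120) := by
  intro x y
  have hm : ∀ s x, Measurable fun ω => partialField a s ω x := fun s x =>
    (measurable_partialField ha s).comp measurable_prodMk_right
  refine (Lp.eLpNorm_lim_le_liminf_eLpNorm
    (f := fun j ω => partialField a (exhaustion j) ω x - partialField a (exhaustion j) ω y)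
    (fun j => ((hm _ _).sub (hm _ _)).aestronglyMeasurable) _ ?_).trans
      (liminf_le_of_forall_le (Eventually.of_forall fun j => ?_))
  · filter_upwards [ae_tendsto_partialField ha hind hM h0 x,
      ae_tendsto_partialField ha hind hM h0 y] with ω hx hy
    exact hx.sub hy
  · have h := eLpNorm_sum_le ha hind hM h0 (exhaustion j)
      (fun n => renormalizedPatch n x - renormalizedPatch n y) hp
      (by have := growthModulus_nonneg x y; positivity)
      (sum_norm_renormalizedPatch_sub_le (exhaustion j) x y)
    rw [mul_assoc]
    refine Eq.trans_le ?_ h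
    congr 1
    ext1 ω
    simp only [partialField, smul_sub, Finset.sum_sub_distrib]

/-! ### Convergence in `L²` -/

lemma eLpNorm_two_sq {α E : Type*} [MeasurableSpace α] {ν : Measure α} [NormedAddCommGroup E]
    (f : α → E) : eLpNorm f 2 ν ^ 2 = ∫⁻ x, ‖f x‖ₑ ^ 2 ∂ν := by
  have := eLpNorm_nnreal_pow_eq_lintegral (μ := ν) (f := f) (p := 2) (by norm_num)
  simpa using this

/-- A bound for the squared error of the partial sums on the ball of radius `N`. -/
def ballError (M : ℝ) (N k : ℕ) : ℝ≥0∞ :=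
  ENNReal.ofReal (2 * momentConst M 2 * (6120 * (1 + N) ^ 2) * (1 / 2) ^ k) ^ 2 *
    volume (Metric.ball (0 : Plane) N)

lemma lintegral_randomField_sub_sq_le (ha : ∀ n, Measurable (a n)) (hind : iIndepFun a μ)
    (hM : ∀ n, ∀ᵐ ω ∂μ, |a n ω| ≤ M) (h0 : ∀ n, ∫ ω, a n ω ∂μ = 0) (N : ℕ) {k : ℕ}
    {s : Finset Lattice} (hs : exhaustion k ⊆ s) :
    ∫⁻ z : Ω × Plane, ‖randomField a z.1 z.2 - partialField a s z.1 z.2‖ₑ ^ 2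
      ∂(μ.prod (volume.restrict (Metric.ball (0 : Plane) N))) ≤ ballError M N k := by
  have hmeas : Measurable fun z : Ω × Plane =>
      ‖randomField a z.1 z.2 - partialField a s z.1 z.2‖ₑ ^ 2 :=
    ((measurable_randomField ha).sub (measurable_partialField ha s)).enorm.pow_const 2
  rw [lintegral_prod_symm _ hmeas.aemeasurable]
  refine (setLIntegral_mono' (g := fun _ => ENNReal.ofReal
    (2 * momentConst M 2 * (6120 * (1 + N) ^ 2) * (1 / 2) ^ k) ^ 2)
    Metric.isOpen_ball.measurableSet fun x hx => ?_).trans_eq (setLIntegral_const _ _)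
  have h := eLpNorm_randomField_sub_partialField_le ha hind hM h0 x hs
  dsimp only
  rw [← eLpNorm_two_sq (fun ω => randomField a ω x - partialField a s ω x)]
  have hx' : ‖x‖ ≤ N := by simpa using (Metric.mem_ball.1 hx).le
  have := momentConst_nonneg M 2
  gcongr
  refine h.trans (ENNReal.ofReal_le_ofReal ?_)
  unfold errorConst
  gcongr

lemma tendsto_ballError (M : ℝ) (N : ℕ) : Tendsto (ballError M N) atTop (𝓝 0) := by
  unfold ballError
  have h1 : Tendsto (fun k : ℕ => 2 * momentConst M 2 * (6120 * (1 + (N : ℝ)) ^ 2) * (1 / 2) ^ k)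
      atTop (𝓝 (2 * momentConst M 2 * (6120 * (1 + (N : ℝ)) ^ 2) * 0)) :=
    (tendsto_pow_atTop_nhds_zero_of_lt_one (by norm_num) (by norm_num)).const_mul _
  have h2 := ENNReal.Tendsto.mul_const (b := volume (Metric.ball (0 : Plane) N))
    (ENNReal.Tendsto.pow (n := 2) (ENNReal.tendsto_ofReal h1)) (Or.inr measure_ball_lt_top.ne)
  simpa using h2

lemma ballError_ne_top (M : ℝ) (N k : ℕ) : ballError M N k ≠ ∞ := by
  unfold ballError
  exact ENNReal.mul_ne_top (by simp) measure_ball_lt_top.ne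

lemma tsum_ballError_ne_top (M : ℝ) (N : ℕ) : ∑' k, ballError M N k ≠ ∞ := by
  unfold ballError
  have hc := momentConst_nonneg M 2
  rw [ENNReal.tsum_mul_right]
  refine ENNReal.mul_ne_top ?_ measure_ball_lt_top.ne
  have hs : Summable fun k : ℕ => (2 * momentConst M 2 * (6120 * (1 + (N : ℝ)) ^ 2)) ^ 2 *
      (1 / 4 : ℝ) ^ k :=
    (summable_geometric_of_lt_one (by norm_num) (by norm_num)).mul_left _
  convert! hs.tsum_ofReal_ne_top using 3 with k
  rw [← ENNReal.ofReal_pow (by positivity), mul_pow, ← pow_mul, mul_comm k 2, pow_mul]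
  norm_num

lemma memLp_randomField (ha : ∀ n, Measurable (a n)) (hind : iIndepFun a μ)
    (hM : ∀ n, ∀ᵐ ω ∂μ, |a n ω| ≤ M) (h0 : ∀ n, ∫ ω, a n ω ∂μ = 0) (N : ℕ) :
    MemLp (Function.uncurry (randomField a)) 2
      (μ.prod (volume.restrict (Metric.ball (0 : Plane) N))) := by
  refine ⟨(measurable_randomField ha).aestronglyMeasurable, ?_⟩
  have h := lintegral_randomField_sub_sq_le ha hind hM h0 N (k := 0) (s := ∅)
    (by rw [exhaustion_zero])
  simp only [partialField, Finset.sum_empty, sub_zero] at h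
  have h2 := eLpNorm_two_sq (ν := μ.prod (volume.restrict (Metric.ball (0 : Plane) N)))
    (Function.uncurry (randomField a))
  have : eLpNorm (Function.uncurry (randomField a)) 2
      (μ.prod (volume.restrict (Metric.ball (0 : Plane) N))) ^ 2 < ∞ := by
    rw [h2]; exact h.trans_lt (ballError_ne_top M N 0).lt_top
  rwa [ENNReal.pow_lt_top_iff, or_iff_left (by norm_num)] at this

lemma tendsto_eLpNorm_randomField_sub (ha : ∀ n, Measurable (a n)) (hind : iIndepFun a μ)
    (hM : ∀ n, ∀ᵐ ω ∂μ, |a n ω| ≤ M) (h0 : ∀ n, ∫ ω, a n ω ∂μ = 0) (N : ℕ) :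
    Tendsto (fun s : Finset Lattice =>
      eLpNorm (fun z : Ω × Plane =>
        randomField a z.1 z.2 - ∑ n ∈ s, a n z.1 • renormalizedPatch n z.2) 2
        (μ.prod (volume.restrict (Metric.ball (0 : Plane) N)))) atTop (𝓝 0) := by
  rw [ENNReal.tendsto_nhds_zero]
  intro ε hε
  obtain ⟨k, hk⟩ := (ENNReal.tendsto_nhds_zero.1 (tendsto_ballError M N) (ε ^ 2)
    (by positivity)).exists
  -- The error bound holds for every finite set containing `exhaustion k`, which is exactly
  -- unconditional convergence.
  filter_upwards [eventually_ge_atTop (exhaustion k)] with s hs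
  rw [← ENNReal.pow_le_pow_left_iff (n := 2) (by norm_num), eLpNorm_two_sq]
  exact (lintegral_randomField_sub_sq_le ha hind hM h0 N hs).trans hk

/-- Almost surely, the partial sums along the exhaustion converge to the random field in
`L²` on every ball. -/
lemma ae_tendsto_lintegral_sub_sq (ha : ∀ n, Measurable (a n)) (hind : iIndepFun a μ)
    (hM : ∀ n, ∀ᵐ ω ∂μ, |a n ω| ≤ M) (h0 : ∀ n, ∫ ω, a n ω ∂μ = 0) :
    ∀ᵐ ω ∂μ, ∀ N : ℕ, Tendsto (fun k => ∫⁻ x in Metric.ball (0 : Plane) N,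
      ‖randomField a ω x - partialField a (exhaustion k) ω x‖ₑ ^ 2) atTop (𝓝 0) := by
  rw [ae_all_iff]
  intro N
  have hmeas : ∀ s, Measurable fun z : Ω × Plane =>
      ‖randomField a z.1 z.2 - partialField a s z.1 z.2‖ₑ ^ 2 := fun s =>
    ((measurable_randomField ha).sub (measurable_partialField ha s)).enorm.pow_const 2
  have hm : ∀ k, Measurable fun ω => ∫⁻ x in Metric.ball (0 : Plane) N,
      ‖randomField a ω x - partialField a (exhaustion k) ω x‖ₑ ^ 2 := fun k =>
    (hmeas (exhaustion k)).lintegral_prod_right'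
  have hsum : ∫⁻ ω, (∑' k, ∫⁻ x in Metric.ball (0 : Plane) N,
      ‖randomField a ω x - partialField a (exhaustion k) ω x‖ₑ ^ 2) ∂μ ≠ ∞ := by
    rw [lintegral_tsum fun k => (hm k).aemeasurable]
    refine ne_top_of_le_ne_top (tsum_ballError_ne_top M N) (ENNReal.tsum_le_tsum fun k => ?_)
    rw [← lintegral_prod _ (hmeas _).aemeasurable]
    exact lintegral_randomField_sub_sq_le ha hind hM h0 N le_rfl
  -- The sum of the squared errors has finite expectation, so almost surely it is finite and its
  -- terms tend to `0`.
  filter_upwards [ae_lt_top (Measurable.tsum hm) hsum] with ω hω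
  exact ENNReal.tendsto_atTop_zero_of_tsum_ne_top hω.ne

end

section

/-! ### The kernel as a fundamental solution -/

/-- The rotation by a right angle as a continuous linear map. -/
def perpCLM : Plane →L[ℝ] Plane :=
  LinearMap.toContinuousLinearMap
    { toFun := perp
      map_add' := fun z w => by
        have := perp_sub (z + w) w
        rw [add_sub_cancel_right, sub_eq_iff_eq_add] at this
        exact this
      map_smul' := perp_smul }

@[simp] lemma perpCLM_apply (z : Plane) : perpCLM z = perp z := rfl

/-- The unit vector with polar angle `θ`. -/
def dir (θ : ℝ) : Plane := cos θ • basisVec 0 + sin θ • basisVec 1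

lemma polar_eq_smul_dir (r θ : ℝ) : (!₂[r * cos θ, r * sin θ] : Plane) = r • dir θ := by
  ext i; fin_cases i <;> simp [dir, basisVec]

lemma perp_dir (θ : ℝ) : perp (dir θ) = (-sin θ) • basisVec 0 + cos θ • basisVec 1 := by
  ext i; fin_cases i <;> simp [dir, basisVec, perp]

lemma perp_perp (z : Plane) : perp (perp z) = -z := by
  ext i; fin_cases i <;> simp [perp]

lemma norm_dir (θ : ℝ) : ‖dir θ‖ = 1 := by
  have := norm_polar one_pos θ
  rwa [polar_eq_smul_dir, one_smul] at this

lemma hasDerivAt_dir (θ : ℝ) : HasDerivAt dir (perp (dir θ)) θ := by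
  rw [perp_dir]
  exact ((hasDerivAt_cos θ).smul_const _).add ((hasDerivAt_sin θ).smul_const _)

lemma continuous_dir : Continuous dir :=
  continuous_iff_continuousAt.2 fun θ => (hasDerivAt_dir θ).continuousAt

lemma biotSavart_smul_dir {r : ℝ} (hr : 0 < r) (θ : ℝ) :
    biotSavart (r • dir θ) = (1 / (2 * π * r)) • perp (dir θ) := by
  rw [biotSavart, norm_smul, norm_dir, perp_smul, smul_smul, norm_of_nonneg hr.le]
  congr 1
  field_simp

lemma exists_radius {ψ : Plane → ℝ} (hc : HasCompactSupport ψ) :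
    ∃ R : ℝ, 0 < R ∧ ∀ x, R ≤ ‖x‖ → ψ x = 0 ∧ fderiv ℝ ψ x = 0 := by
  obtain ⟨R, hR⟩ := hc.isCompact.isBounded.subset_ball 0
  refine ⟨max R 1, by positivity, fun x hx => ?_⟩
  have hx' : x ∉ tsupport ψ := fun h => by
    have := hR h
    rw [mem_ball_zero_iff] at this
    exact absurd ((le_max_left R 1).trans hx) (not_le.2 this)
  exact ⟨image_eq_zero_of_notMem_tsupport hx',
    by_contra fun h => hx' (support_fderiv_subset ℝ (Function.mem_support.2 h))⟩

/-- The Jacobian `r` cancels the pole `1/(2πr)`, leaving a bounded integrand. -/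
lemma integral_fderiv_biotSavart_polar (ψ : Plane → ℝ) (L : Plane →L[ℝ] Plane) :
    ∫ z, fderiv ℝ ψ z (L (biotSavart z)) = (1 / (2 * π)) *
      ∫ p in Set.Ioi (0 : ℝ) ×ˢ Set.Ioo (-π) π,
        fderiv ℝ ψ (p.1 • dir p.2) (L (perp (dir p.2))) := by
  rw [integral_polar, polarCoord_target, ← integral_const_mul]
  refine setIntegral_congr_fun (measurableSet_Ioi.prod measurableSet_Ioo) fun p hp => ?_
  have hr : 0 < p.1 := hp.1
  rw [polar_eq_smul_dir, biotSavart_smul_dir hr, map_smul, map_smul, smul_eq_mul]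
  field_simp

lemma integrableOn_polar {ψ : Plane → ℝ} (hψ : ContDiff ℝ 1 ψ) (hc : HasCompactSupport ψ)
    (L : Plane →L[ℝ] Plane) :
    IntegrableOn (fun p : ℝ × ℝ => fderiv ℝ ψ (p.1 • dir p.2) (L (perp (dir p.2))))
      (Set.Ioi (0 : ℝ) ×ˢ Set.Ioo (-π) π) := by
  obtain ⟨R, hR0, hR⟩ := exists_radius hc
  have hd := hψ.continuous_fderiv one_ne_zero
  have hdir := continuous_dir
  have hcont : Continuous fun p : ℝ × ℝ =>
      fderiv ℝ ψ (p.1 • dir p.2) (L (perpCLM (dir p.2))) := by fun_prop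
  refine IntegrableOn.of_forall_sdiff_eq_zero (s := Set.Icc 0 R ×ˢ Set.Icc (-π) π)
    (hcont.continuousOn.integrableOn_compact (isCompact_Icc.prod isCompact_Icc))
    (measurableSet_Ioi.prod measurableSet_Ioo) fun p hp => ?_
  have h1 : 0 < p.1 := hp.1.1
  have h2 := hp.1.2
  have h3 : R ≤ p.1 := by
    by_contra h
    exact hp.2 ⟨⟨h1.le, (not_le.1 h).le⟩, ⟨h2.1.le, h2.2.le⟩⟩
  rw [(hR _ (by rwa [norm_smul, norm_dir, mul_one, norm_of_nonneg h1.le])).2]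
  rfl

/-- The kernel is divergence free. -/
lemma integral_fderiv_biotSavart {ψ : Plane → ℝ} (hψ : ContDiff ℝ 1 ψ) (hc : HasCompactSupport ψ) :
    ∫ z, fderiv ℝ ψ z (biotSavart z) = 0 := by
  have h := integral_fderiv_biotSavart_polar ψ (.id ℝ Plane)
  have hint := integrableOn_polar hψ hc (.id ℝ Plane)
  simp only [ContinuousLinearMap.id_apply] at h hint
  rw [Measure.volume_eq_prod] at h hint
  rw [h, setIntegral_prod _ hint, setIntegral_eq_zero_of_forall_eq_zero, mul_zero]
  intro r hr
  have hr : (0 : ℝ) < r := hr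
  have hd := hψ.continuous_fderiv one_ne_zero
  have hdir := continuous_dir
  have hcont : Continuous fun θ => fderiv ℝ ψ (r • dir θ) (r • perpCLM (dir θ)) := by fun_prop
  -- On each circle `K` is tangential, so the integrand is an angular derivative and integrates to
  -- `0`.
  have hder : ∀ θ, HasDerivAt (fun θ => ψ (r • dir θ))
      (fderiv ℝ ψ (r • dir θ) (r • perp (dir θ))) θ := fun θ =>
    ((hψ.differentiable one_ne_zero _).hasFDerivAt).comp_hasDerivAt θ
      ((hasDerivAt_dir θ).const_smul r)
  have hftc := intervalIntegral.integral_eq_sub_of_hasDerivAt (a := -π) (b := π)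
    (fun θ _ => hder θ) (hcont.intervalIntegrable _ _)
  have hper : dir π = dir (-π) := by simp [dir]
  rw [hper, sub_self, intervalIntegral.integral_of_le (by linarith [pi_pos]),
    integral_Ioc_eq_integral_Ioo] at hftc
  simp only [map_smul, smul_eq_mul] at hftc
  rw [integral_const_mul] at hftc
  exact (mul_eq_zero.1 hftc).resolve_left hr.ne'

/-- The curl of the kernel is the Dirac mass at the origin. -/
lemma integral_fderiv_perp_biotSavart {ψ : Plane → ℝ} (hψ : ContDiff ℝ 1 ψ)
    (hc : HasCompactSupport ψ) :
    ∫ z, fderiv ℝ ψ z (perp (biotSavart z)) = ψ 0 := by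
  have h := integral_fderiv_biotSavart_polar ψ perpCLM
  have hint := integrableOn_polar hψ hc perpCLM
  simp only [perpCLM_apply, perp_perp] at h hint
  rw [Measure.volume_eq_prod] at h hint
  rw [h, ← setIntegral_prod_swap]
  obtain ⟨R, hR0, hR⟩ := exists_radius hc
  have hd := hψ.continuous_fderiv one_ne_zero
  -- The rotated kernel is radial and points inward, so each ray contributes `-(0 - ψ 0)`.
  have hinner : ∀ θ, ∫ r in Set.Ioi (0 : ℝ), fderiv ℝ ψ (r • dir θ) (-dir θ) = ψ 0 := by
    intro θ
    have hder : ∀ r : ℝ, HasDerivAt (fun r : ℝ => ψ (r • dir θ))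
        (fderiv ℝ ψ (r • dir θ) (dir θ)) r := fun r => by
      have h1 : HasDerivAt (fun r : ℝ => r • dir θ) (dir θ) r := by
        simpa using (hasDerivAt_id r).smul_const (dir θ)
      exact ((hψ.differentiable one_ne_zero _).hasFDerivAt).comp_hasDerivAt r h1
    have hcont : Continuous fun r : ℝ => fderiv ℝ ψ (r • dir θ) (dir θ) := by fun_prop
    have hzero : ∀ r, R ≤ r → ψ (r • dir θ) = 0 ∧ fderiv ℝ ψ (r • dir θ) = 0 := fun r hr =>
      hR _ (by rwa [norm_smul, norm_dir, mul_one, norm_of_nonneg (hR0.le.trans hr)])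
    have hI : IntegrableOn (fun r : ℝ => fderiv ℝ ψ (r • dir θ) (dir θ)) (Set.Ioi 0) := by
      refine IntegrableOn.of_forall_sdiff_eq_zero (s := Set.Icc 0 R)
        (hcont.continuousOn.integrableOn_compact isCompact_Icc) measurableSet_Ioi fun r hr => ?_
      have h1 : 0 < r := hr.1
      have h3 : R ≤ r := by
        by_contra h
        exact hr.2 ⟨h1.le, (not_le.1 h).le⟩
      rw [(hzero r h3).2]
      rfl
    have hlim : Tendsto (fun r : ℝ => ψ (r • dir θ)) atTop (𝓝 0) :=
      tendsto_const_nhds.congr' ((eventually_ge_atTop R).mono fun r hr => (hzero r hr).1.symm)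
    have := integral_Ioi_of_hasDerivAt_of_tendsto' (fun r _ => hder r) hI hlim
    simp only [map_neg]
    rw [integral_neg, this]
    simp
  have hsw := setIntegral_prod _ hint.swap
  simp only [Function.comp_def, Prod.fst_swap, Prod.snd_swap] at hsw ⊢
  rw [hsw]
  simp only [hinner]
  rw [setIntegral_const, Measure.real, volume_Ioo, ENNReal.toReal_ofReal (by linarith [pi_pos])]
  simp only [smul_eq_mul]
  field_simp
  ring

end

section

/-! ### Weak equations for the patches -/

lemma enorm_patchVelocity_le (x : Plane) : ‖patchVelocity x‖ₑ ≤ ENNReal.ofReal 12 :=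
  (enorm_integral_le_lintegral_enorm _).trans (lintegral_norm_biotSavart_le x)

lemma norm_patchVelocity_le (x : Plane) : ‖patchVelocity x‖ ≤ 12 := by
  have := enorm_patchVelocity_le x
  rwa [← ofReal_norm, ENNReal.ofReal_le_ofReal_iff (by norm_num)] at this

lemma norm_renormalizedPatch_le_const (n : Lattice) (x : Plane) :
    ‖renormalizedPatch n x‖ ≤ 24 := by
  refine (norm_sub_le _ _).trans ?_
  have := norm_patchVelocity_le (x - latticePoint n)
  have := norm_patchVelocity_le (-latticePoint n)
  linarith

lemma locallyIntegrable_of_bound {u : Plane → Plane} (hu : Measurable u) {C : ℝ}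
    (hC : ∀ x, ‖u x‖ ≤ C) : LocallyIntegrable u := fun x =>
  ⟨Metric.ball x 1, Metric.ball_mem_nhds x one_pos,
    Measure.integrableOn_of_bounded measure_ball_lt_top.ne hu.aestronglyMeasurable
      (ae_of_all _ hC)⟩

lemma integrable_fderiv_apply {φ : Plane → ℝ} (hφ : ContDiff ℝ 1 φ) (hc : HasCompactSupport φ)
    (L : Plane →L[ℝ] Plane) {u : Plane → Plane} (hu : LocallyIntegrable u) :
    Integrable fun x => fderiv ℝ φ x (L (u x)) := by
  have hd := hφ.continuous_fderiv one_ne_zero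
  have h1 : Integrable fun x => ‖fderiv ℝ φ x‖ • u x :=
    hu.integrable_smul_left_of_hasCompactSupport hd.norm (hc.fderiv ℝ).norm
  refine (h1.norm.const_mul ‖L‖).mono' ?_ (ae_of_all _ fun x => ?_)
  · exact (isBoundedBilinearMap_apply.continuous.comp_aestronglyMeasurable
      (hd.aestronglyMeasurable.prodMk (L.continuous.comp_aestronglyMeasurable
        hu.aestronglyMeasurable)))
  · rw [norm_smul, norm_norm]
    calc _ ≤ ‖fderiv ℝ φ x‖ * (‖L‖ * ‖u x‖) :=
          (ContinuousLinearMap.le_opNorm _ _).trans (by gcongr; exact L.le_opNorm _)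
      _ = _ := by ring

lemma integral_fderiv_const {φ : Plane → ℝ} (hφ : ContDiff ℝ 1 φ) (hc : HasCompactSupport φ)
    (w : Plane) : ∫ x, fderiv ℝ φ x w = 0 := by
  have hint : Integrable fun x => fderiv ℝ φ x w :=
    integrable_fderiv_apply hφ hc (.id ℝ Plane) (u := fun _ => w) (locallyIntegrable_const w)
  have := integral_mul_fderiv_eq_neg_fderiv_mul_of_integrable (μ := (volume : Measure Plane))
    (f := fun _ => (1 : ℝ)) (g := φ) (v := w) (by simp) (by simpa using hint)
    (by simpa using hφ.continuous.integrable_of_hasCompactSupport hc)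
    (fun x _ => by fun_prop) (fun x _ => hφ.differentiable one_ne_zero x)
  simpa using this

/-- `L ∘ K` has divergence `-c δ₀`. -/
def KernelPairing (L : Plane →L[ℝ] Plane) (c : ℝ) : Prop :=
  ∀ ψ : Plane → ℝ, ContDiff ℝ 1 ψ → HasCompactSupport ψ →
    ∫ z, fderiv ℝ ψ z (L (biotSavart z)) = c * ψ 0

lemma kernelPairing_id : KernelPairing (.id ℝ Plane) 0 := fun ψ h1 h2 => by
  rw [zero_mul]; exact integral_fderiv_biotSavart h1 h2

lemma kernelPairing_perp : KernelPairing perpCLM 1 := fun ψ h1 h2 => by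
  rw [one_mul]; exact integral_fderiv_perp_biotSavart h1 h2

variable {L : Plane →L[ℝ] Plane} {c : ℝ}

lemma integrable_fderiv_biotSavart_prod {φ : Plane → ℝ} (hφ : ContDiff ℝ 1 φ)
    (hc : HasCompactSupport φ) (L : Plane →L[ℝ] Plane) :
    Integrable (Function.uncurry fun x y => fderiv ℝ φ x (L (biotSavart (x - y))))
      ((volume : Measure Plane).prod (volume.restrict (unitSquare 0))) := by
  have hd := hφ.continuous_fderiv one_ne_zero
  have hmK : Measurable fun p : Plane × Plane => biotSavart (p.1 - p.2) :=
    measurable_biotSavart.comp (by fun_prop)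
  have hmeas : StronglyMeasurable
      (Function.uncurry fun x y => fderiv ℝ φ x (L (biotSavart (x - y)))) :=
    isBoundedBilinearMap_apply.continuous.comp_stronglyMeasurable
      ((hd.stronglyMeasurable.comp_measurable measurable_fst).prodMk
        (L.continuous.comp_stronglyMeasurable hmK.stronglyMeasurable))
  refine ⟨hmeas.aestronglyMeasurable, ?_⟩
  have hfin : Integrable fun x => fderiv ℝ φ x :=
    hd.integrable_of_hasCompactSupport (hc.fderiv ℝ)
  rw [HasFiniteIntegral, lintegral_prod _ hmeas.enorm.aemeasurable]
  calc _ ≤ ∫⁻ x, ‖fderiv ℝ φ x‖ₑ * (‖L‖ₑ * ENNReal.ofReal 12) := by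
        apply lintegral_mono
        intro x
        dsimp only [Function.uncurry]
        calc _ ≤ ∫⁻ y in unitSquare 0, (‖fderiv ℝ φ x‖ₑ * ‖L‖ₑ) * ‖biotSavart (x - y)‖ₑ := by
              apply lintegral_mono
              intro y
              dsimp only
              rw [mul_assoc]
              refine (ContinuousLinearMap.le_opENorm _ _).trans ?_
              gcongr
              exact ContinuousLinearMap.le_opENorm _ _
          _ = (‖fderiv ℝ φ x‖ₑ * ‖L‖ₑ) * ∫⁻ y in unitSquare 0, ‖biotSavart (x - y)‖ₑ := by
              apply lintegral_const_mul
              exact (measurable_biotSavart.comp (by fun_prop)).enorm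
          _ ≤ _ := by
              rw [mul_assoc]
              gcongr
              exact lintegral_norm_biotSavart_le x
    _ = (∫⁻ x, ‖fderiv ℝ φ x‖ₑ) * (‖L‖ₑ * ENNReal.ofReal 12) :=
        lintegral_mul_const _ hd.measurable.enorm
    _ < ∞ := ENNReal.mul_lt_top hfin.2 (ENNReal.mul_lt_top enorm_lt_top ENNReal.ofReal_lt_top)

/-- Fubini moves the `x`-integral inside; for each `y` the kernel identity applies to the translated
test function. -/
lemma KernelPairing.patch (hL : KernelPairing L c) {φ : Plane → ℝ} (hφ : ContDiff ℝ 1 φ)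
    (hc : HasCompactSupport φ) :
    ∫ x, fderiv ℝ φ x (L (patchVelocity x)) = c * ∫ y in unitSquare 0, φ y := by
  have h1 : ∀ x, fderiv ℝ φ x (L (patchVelocity x)) =
      ∫ y in unitSquare 0, fderiv ℝ φ x (L (biotSavart (x - y))) := fun x =>
    (((fderiv ℝ φ x).comp L).integral_comp_comm (integrableOn_biotSavart x)).symm
  simp only [h1]
  rw [integral_integral_swap (integrable_fderiv_biotSavart_prod hφ hc L), ← integral_const_mul]
  congr 1
  ext1 y
  rw [← integral_add_right_eq_self _ y]
  have h2 := hL (fun z => φ (z + y)) (hφ.comp (by fun_prop))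
    (hc.comp_homeomorph (Homeomorph.addRight y))
  simp only [fderiv_comp_add_right, zero_add] at h2
  simpa using h2

lemma add_latticePoint_mem_unitSquare (n : Lattice) (y : Plane) :
    y + latticePoint n ∈ unitSquare n ↔ y ∈ unitSquare 0 := by
  simp only [unitSquare, latticePoint, Set.mem_ofPred_eq, PiLp.add_apply, Pi.zero_apply,
    Int.cast_zero, zero_add]
  refine forall_congr' fun i => ?_
  constructor <;> rintro ⟨h1, h2⟩ <;> constructor <;> linarith

lemma locallyIntegrable_renormalizedPatch (n : Lattice) :
    LocallyIntegrable (renormalizedPatch n) :=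
  locallyIntegrable_of_bound (measurable_renormalizedPatch n) (norm_renormalizedPatch_le_const n)

lemma KernelPairing.renormalizedPatch (hL : KernelPairing L c) {φ : Plane → ℝ}
    (hφ : ContDiff ℝ 1 φ) (hc : HasCompactSupport φ) (n : Lattice) :
    ∫ x, fderiv ℝ φ x (L (renormalizedPatch n x)) = c * ∫ y in unitSquare n, φ y := by
  have hv : LocallyIntegrable fun x => patchVelocity (x - latticePoint n) :=
    locallyIntegrable_of_bound (measurable_patchVelocity.comp (by fun_prop))
      fun x => norm_patchVelocity_le _
  unfold RandomVorticity.renormalizedPatch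
  simp only [map_sub]
  rw [integral_sub (integrable_fderiv_apply hφ hc L hv)
    (integrable_fderiv_apply hφ hc L (locallyIntegrable_const _)), integral_fderiv_const hφ hc,
    sub_zero, ← integral_add_right_eq_self _ (latticePoint n)]
  have h := hL.patch (φ := fun z => φ (z + latticePoint n)) (hφ.comp (by fun_prop))
    (hc.comp_homeomorph (Homeomorph.addRight (latticePoint n)))
  simp only [fderiv_comp_add_right] at h
  simp only [add_sub_cancel_right]
  rw [h]
  congr 1
  rw [← integral_indicator (measurableSet_unitSquare 0),
    ← integral_indicator (measurableSet_unitSquare n),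
    ← integral_add_right_eq_self ((unitSquare n).indicator φ) (latticePoint n)]
  congr 1
  ext1 y
  have hy := add_latticePoint_mem_unitSquare n y
  by_cases h0 : y ∈ unitSquare 0
  · rw [Set.indicator_of_mem h0, Set.indicator_of_mem (hy.2 h0)]
  · rw [Set.indicator_of_notMem h0, Set.indicator_of_notMem fun h => h0 (hy.1 h)]

/-! ### The vorticity -/

lemma mem_unitSquare_iff (n : Lattice) (x : Plane) : x ∈ unitSquare n ↔ floorPoint x = n := by
  simp only [unitSquare, floorPoint, Set.mem_ofPred_eq, funext_iff, Int.floor_eq_iff]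

lemma vorticity_eq (a : Lattice → ℝ) (x : Plane) : vorticity a x = a (floorPoint x) := by
  unfold vorticity
  rw [tsum_eq_single (floorPoint x)]
  · rw [Set.indicator_of_mem ((mem_unitSquare_iff _ _).2 rfl)]
  · intro n hn
    rw [Set.indicator_of_notMem]
    rw [mem_unitSquare_iff]
    exact hn.symm

lemma sum_indicator_unitSquare (a : Lattice → ℝ) (s : Finset Lattice) (x : Plane) :
    ∑ n ∈ s, (unitSquare n).indicator (fun _ => a n) x =
      if floorPoint x ∈ s then a (floorPoint x) else 0 := by
  classical
  rw [← Finset.sum_ite_eq s (floorPoint x) a]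
  refine Finset.sum_congr rfl fun n _ => ?_
  simp only [Set.indicator, mem_unitSquare_iff]

lemma measurable_vorticity (a : Lattice → ℝ) : Measurable (vorticity a) := by
  have : vorticity a = fun x => a (floorPoint x) := funext (vorticity_eq a)
  rw [this]
  have hf : Measurable floorPoint := measurable_pi_iff.2 fun i =>
    Int.measurable_floor.comp (by fun_prop : Measurable fun x : Plane => x i)
  exact (measurable_of_countable a).comp hf

/-- The partial sums of the deterministic series with weights `a`. -/
def patchSum (a : Lattice → ℝ) (s : Finset Lattice) (x : Plane) : Plane :=
  ∑ n ∈ s, a n • renormalizedPatch n x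

lemma measurable_patchSum (a : Lattice → ℝ) (s : Finset Lattice) : Measurable (patchSum a s) :=
  Finset.measurable_sum _ fun n _ => by
    have := (measurable_renormalizedPatch n).const_smul (a n)
    exact this

lemma norm_patchSum_le (a : Lattice → ℝ) (s : Finset Lattice) (x : Plane) :
    ‖patchSum a s x‖ ≤ ∑ n ∈ s, |a n| * 24 := by
  refine (norm_sum_le _ _).trans (Finset.sum_le_sum fun n _ => ?_)
  rw [norm_smul, norm_eq_abs]
  gcongr
  exact norm_renormalizedPatch_le_const n x

lemma locallyIntegrable_patchSum (a : Lattice → ℝ) (s : Finset Lattice) :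
    LocallyIntegrable (patchSum a s) :=
  locallyIntegrable_of_bound (measurable_patchSum a s) (norm_patchSum_le a s)

lemma KernelPairing.patchSum (hL : KernelPairing L c) {φ : Plane → ℝ}
    (hφ : ContDiff ℝ 1 φ) (hc : HasCompactSupport φ) (a : Lattice → ℝ) (s : Finset Lattice) :
    ∫ x, fderiv ℝ φ x (L (patchSum a s x)) =
      c * ∫ x, φ x * ∑ n ∈ s, (unitSquare n).indicator (fun _ => a n) x := by
  have hφi : Integrable φ := hφ.continuous.integrable_of_hasCompactSupport hc
  unfold RandomVorticity.patchSum
  simp only [map_sum, map_smul, smul_eq_mul, Finset.mul_sum]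
  have heq : ∀ n x, φ x * (unitSquare n).indicator (fun _ => a n) x =
      a n * (unitSquare n).indicator φ x := fun n x => by
    by_cases hx : x ∈ unitSquare n <;> simp [hx, mul_comm]
  simp only [heq]
  rw [integral_finsetSum _ fun n _ => (integrable_fderiv_apply hφ hc L
    (locallyIntegrable_renormalizedPatch n)).const_mul _,
    integral_finsetSum _ fun n _ =>
      (hφi.indicator (measurableSet_unitSquare n)).const_mul _, Finset.mul_sum]
  refine Finset.sum_congr rfl fun n _ => ?_
  rw [integral_const_mul, integral_const_mul, hL.renormalizedPatch hφ hc,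
    integral_indicator (measurableSet_unitSquare n)]
  ring

/-! ### Passage to the limit -/

lemma isFiniteMeasure_restrict_ball (R : ℝ) :
    IsFiniteMeasure ((volume : Measure Plane).restrict (Metric.ball 0 R)) :=
  ⟨by rw [Measure.restrict_apply_univ]; exact measure_ball_lt_top⟩

/-- `u` is the limit in `L²_loc` of the partial sums along the exhaustion. -/
def IsLimitOfPatchSums (a : Lattice → ℝ) (u : Plane → Plane) : Prop :=
  ∀ N : ℕ, Tendsto (fun k => ∫⁻ x in Metric.ball (0 : Plane) N,
    ‖u x - patchSum a (exhaustion k) x‖ₑ ^ 2) atTop (𝓝 0)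

variable {a : Lattice → ℝ} {u : Plane → Plane}

lemma IsLimitOfPatchSums.tendsto_eLpNorm (h : IsLimitOfPatchSums a u) (N : ℕ) :
    Tendsto (fun k => eLpNorm (fun x => u x - patchSum a (exhaustion k) x) 2
      (volume.restrict (Metric.ball (0 : Plane) N))) atTop (𝓝 0) := by
  rw [ENNReal.tendsto_nhds_zero]
  intro ε hε
  filter_upwards [ENNReal.tendsto_nhds_zero.1 (h N) (ε ^ 2) (by positivity)] with k hk
  rw [← ENNReal.pow_le_pow_left_iff (n := 2) (by norm_num), eLpNorm_two_sq]
  exact hk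

lemma IsLimitOfPatchSums.memL2Loc (h : IsLimitOfPatchSums a u) (hu : Measurable u) :
    MemL2Loc u := by
  intro R
  obtain ⟨N, hN⟩ := exists_nat_ge R
  refine MemLp.mono_measure (μ := volume.restrict (Metric.ball (0 : Plane) N))
    (Measure.restrict_mono (Metric.ball_subset_ball hN) le_rfl) ?_
  obtain ⟨k, hk⟩ := ((h.tendsto_eLpNorm N).eventually_lt_const
    (show (0 : ℝ≥0∞) < 1 by norm_num)).exists
  have := isFiniteMeasure_restrict_ball N
  have h1 : MemLp (fun x => u x - patchSum a (exhaustion k) x) 2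
      (volume.restrict (Metric.ball (0 : Plane) N)) :=
    ⟨(hu.sub (measurable_patchSum _ _)).aestronglyMeasurable, hk.trans ENNReal.one_lt_top⟩
  have h2 : MemLp (patchSum a (exhaustion k)) 2 (volume.restrict (Metric.ball (0 : Plane) N)) :=
    MemLp.of_bound (measurable_patchSum _ _).aestronglyMeasurable _
      (ae_of_all _ (norm_patchSum_le a _))
  convert! h1.add h2 using 1
  ext1 x
  simp

lemma MemL2Loc.locallyIntegrable (h : MemL2Loc u) : LocallyIntegrable u := fun x => by
  have hx : x ∈ Metric.ball (0 : Plane) (‖x‖ + 1) := by simp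
  have := isFiniteMeasure_restrict_ball (‖x‖ + 1)
  exact ⟨_, Metric.isOpen_ball.mem_nhds hx, (h (‖x‖ + 1)).integrable (by norm_num)⟩

/-- Only a ball containing the support of `φ` matters, and there `L²` convergence implies `L¹`
convergence. -/
lemma IsLimitOfPatchSums.tendsto_integral (h : IsLimitOfPatchSums a u) (hu : Measurable u)
    {φ : Plane → ℝ} (hφ : ContDiff ℝ 1 φ) (hc : HasCompactSupport φ) (L : Plane →L[ℝ] Plane) :
    Tendsto (fun k => ∫ x, fderiv ℝ φ x (L (patchSum a (exhaustion k) x))) atTop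
      (𝓝 (∫ x, fderiv ℝ φ x (L (u x)))) := by
  obtain ⟨R, hR0, hR⟩ := exists_radius hc
  obtain ⟨N, hN⟩ := exists_nat_ge R
  set B := Metric.ball (0 : Plane) N with hB
  have hfin : IsFiniteMeasure ((volume : Measure Plane).restrict B) :=
    isFiniteMeasure_restrict_ball N
  have hres : ∀ w : Plane → Plane, ∫ x, fderiv ℝ φ x (L (w x)) =
      ∫ x in B, fderiv ℝ φ x (L (w x)) := fun w => by
    refine (setIntegral_eq_integral_of_forall_compl_eq_zero fun x hx => ?_).symm
    have : R ≤ ‖x‖ := by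
      rw [hB, mem_ball_zero_iff, not_lt] at hx
      exact hN.trans hx
    rw [(hR x this).2]
    rfl
  simp only [hres]
  have hd := hφ.continuous_fderiv one_ne_zero
  obtain ⟨C, hC⟩ := (hc.fderiv ℝ).exists_bound_of_continuous hd
  have hC0 : 0 ≤ C := (norm_nonneg _).trans (hC 0)
  refine tendsto_integral_of_L1' _
    (integrable_fderiv_apply hφ hc L (h.memL2Loc hu).locallyIntegrable).integrableOn.1
    (Eventually.of_forall fun k =>
      (integrable_fderiv_apply hφ hc L (locallyIntegrable_patchSum a _)).integrableOn) ?_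
  have hle : ∀ k, eLpNorm ((fun x => fderiv ℝ φ x (L (patchSum a (exhaustion k) x))) -
      fun x => fderiv ℝ φ x (L (u x))) 1 (volume.restrict B) ≤ ENNReal.ofReal (C * ‖L‖) *
      (eLpNorm (fun x => u x - patchSum a (exhaustion k) x) 2 (volume.restrict B) *
        (volume.restrict B) Set.univ ^ (1 / (1 : ℝ≥0∞).toReal - 1 / (2 : ℝ≥0∞).toReal)) := by
    intro k
    refine (eLpNorm_le_mul_eLpNorm_of_ae_le_mul (c := C * ‖L‖)
      (g := fun x => u x - patchSum a (exhaustion k) x) (ae_of_all _ fun x => ?_) 1).trans ?_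
    · rw [Pi.sub_apply, ← map_sub, ← map_sub, norm_sub_rev (u x), mul_assoc]
      exact (ContinuousLinearMap.le_opNorm _ _).trans (by
        gcongr
        · exact hC x
        · exact L.le_opNorm _)
    · gcongr
      exact eLpNorm_le_eLpNorm_mul_rpow_measure_univ (by norm_num)
        (hu.sub (measurable_patchSum _ _)).aestronglyMeasurable
  refine tendsto_of_tendsto_of_tendsto_of_le_of_le tendsto_const_nhds ?_ (fun _ => bot_le) hle
  have hK : (volume.restrict B) Set.univ ^ (1 / (1 : ℝ≥0∞).toReal - 1 / (2 : ℝ≥0∞).toReal) ≠ ∞ :=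
    ENNReal.rpow_ne_top_of_nonneg (by norm_num) (measure_ne_top _ _)
  have h1 := ENNReal.Tendsto.mul_const (h.tendsto_eLpNorm N) (Or.inr hK)
  rw [zero_mul] at h1
  have h2 := ENNReal.Tendsto.const_mul (a := ENNReal.ofReal (C * ‖L‖)) h1
    (Or.inr ENNReal.ofReal_ne_top)
  rwa [mul_zero] at h2

/-- Both sides of the identity for partial sums converge: the left by `L²_loc` convergence, the
right by domination with `M|φ|`, since at each point the vorticity sums are eventually constant. -/
lemma integral_fderiv_eq_vorticity (hL : KernelPairing L c) (h : IsLimitOfPatchSums a u)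
    (hu : Measurable u) {M : ℝ} (hM : ∀ n, |a n| ≤ M) {φ : Plane → ℝ} (hφ : ContDiff ℝ 1 φ)
    (hc : HasCompactSupport φ) :
    ∫ x, fderiv ℝ φ x (L (u x)) = c * ∫ x, φ x * vorticity a x := by
  have h1 := h.tendsto_integral hu hφ hc L
  simp only [hL.patchSum hφ hc] at h1
  refine tendsto_nhds_unique h1 (Tendsto.const_mul c ?_)
  have hM0 : 0 ≤ M := (abs_nonneg _).trans (hM 0)
  have hφi : Integrable φ := hφ.continuous.integrable_of_hasCompactSupport hc
  refine tendsto_integral_of_dominated_convergence (fun x => M * ‖φ x‖) (fun k => ?_)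
    (hφi.norm.const_mul M) (fun k => ae_of_all _ fun x => ?_) (ae_of_all _ fun x => ?_)
  · refine hφ.continuous.aestronglyMeasurable.mul (Measurable.aestronglyMeasurable ?_)
    exact Finset.measurable_sum _ fun n _ =>
      measurable_const.indicator (measurableSet_unitSquare n)
  · rw [norm_mul, mul_comm, sum_indicator_unitSquare]
    gcongr
    split_ifs
    · exact hM _
    · simpa using hM0
  · refine tendsto_const_nhds.congr' ?_
    filter_upwards [eventually_mem_exhaustion (floorPoint x)] with k hk
    rw [sum_indicator_unitSquare, if_pos hk, vorticity_eq]

/-! ### Distributions -/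

lemma toDistribution_apply {f : Plane → ℝ} (hf : LocallyIntegrable f)
    (φ : 𝓓((⊤ : TopologicalSpace.Opens Plane), ℝ)) : toDistribution f φ = ∫ x, φ x * f x :=
  TestFunction.integralAgainstBilinCLM_eq_integral (hf.locallyIntegrableOn _)

lemma lineDeriv_testFunction_apply (φ : 𝓓((⊤ : TopologicalSpace.Opens Plane), ℝ)) (v x : Plane) :
    (∂_{v} φ : 𝓓((⊤ : TopologicalSpace.Opens Plane), ℝ)) x = fderiv ℝ φ x v := by
  rw [TestFunction.lineDerivOp_eq_lineDerivCLM (𝕜 := ℝ),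
    TestFunction.lineDerivCLM_apply_of_le le_top]
  exact ((φ.contDiff.differentiable (by simp)).differentiableAt).lineDeriv_eq_fderiv

lemma contDiff_one_testFunction (φ : 𝓓((⊤ : TopologicalSpace.Opens Plane), ℝ)) :
    ContDiff ℝ 1 φ := φ.contDiff.of_le (by exact_mod_cast le_top)

lemma lineDeriv_toDistribution_apply {f : Plane → ℝ} (hf : LocallyIntegrable f) (v : Plane)
    (φ : 𝓓((⊤ : TopologicalSpace.Opens Plane), ℝ)) :
    (∂_{v} (toDistribution f)) φ = -∫ x, fderiv ℝ φ x v * f x := by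
  rw [Distribution.lineDerivOp_apply_apply, map_neg, toDistribution_apply hf]
  simp only [lineDeriv_testFunction_apply]

lemma locallyIntegrable_apply (hu : LocallyIntegrable u) (i : Fin 2) :
    LocallyIntegrable fun x => u x i := fun x => by
  obtain ⟨s, hs, hi⟩ := hu x
  exact ⟨s, hs, (EuclideanSpace.proj (𝕜 := ℝ) i).integrable_comp hi⟩

lemma integrable_fderiv_mul_apply (hu : LocallyIntegrable u) {φ : Plane → ℝ}
    (hφ : ContDiff ℝ 1 φ) (hc : HasCompactSupport φ) (v : Plane) (i : Fin 2) :
    Integrable fun x => fderiv ℝ φ x v * u x i := by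
  have := integrable_fderiv_apply hφ hc
    ((EuclideanSpace.proj (𝕜 := ℝ) i).smulRight v : Plane →L[ℝ] Plane) hu
  refine this.congr (ae_of_all _ fun x => ?_)
  simp [mul_comm]

lemma eq_basisVec_combination (z : Plane) : z = z 0 • basisVec 0 + z 1 • basisVec 1 := by
  ext i; fin_cases i <;> simp [basisVec]

lemma distDiv_apply (hu : LocallyIntegrable u)
    (φ : 𝓓((⊤ : TopologicalSpace.Opens Plane), ℝ)) :
    distDiv u φ = -∫ x, fderiv ℝ φ x (u x) := by
  have h : ∀ x, fderiv ℝ φ x (u x) =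
      fderiv ℝ φ x (basisVec 0) * u x 0 + fderiv ℝ φ x (basisVec 1) * u x 1 := fun x => by
    conv_lhs => rw [eq_basisVec_combination (u x)]
    simp only [map_add, map_smul, smul_eq_mul]
    ring
  simp only [h]
  rw [integral_add (integrable_fderiv_mul_apply hu (contDiff_one_testFunction φ)
    φ.hasCompactSupport _ _) (integrable_fderiv_mul_apply hu (contDiff_one_testFunction φ)
    φ.hasCompactSupport _ _), neg_add]
  unfold distDiv
  exact congrArg₂ (· + ·) (lineDeriv_toDistribution_apply (locallyIntegrable_apply hu 0) _ φ)
    (lineDeriv_toDistribution_apply (locallyIntegrable_apply hu 1) _ φ)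

lemma distCurl_apply (hu : LocallyIntegrable u)
    (φ : 𝓓((⊤ : TopologicalSpace.Opens Plane), ℝ)) :
    distCurl u φ = ∫ x, fderiv ℝ φ x (perp (u x)) := by
  have h : ∀ x, fderiv ℝ φ x (perp (u x)) =
      fderiv ℝ φ x (basisVec 1) * u x 0 - fderiv ℝ φ x (basisVec 0) * u x 1 := fun x => by
    conv_lhs => rw [eq_basisVec_combination (perp (u x))]
    simp only [map_add, map_smul, smul_eq_mul, perp]
    simp
    ring
  simp only [h]
  rw [integral_sub (integrable_fderiv_mul_apply hu (contDiff_one_testFunction φ)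
    φ.hasCompactSupport _ _) (integrable_fderiv_mul_apply hu (contDiff_one_testFunction φ)
    φ.hasCompactSupport _ _)]
  unfold distCurl
  have := congrArg₂ (· - ·)
    (lineDeriv_toDistribution_apply (locallyIntegrable_apply hu 1) (basisVec 0) φ)
    (lineDeriv_toDistribution_apply (locallyIntegrable_apply hu 0) (basisVec 1) φ)
  refine Eq.trans this ?_
  ring

lemma locallyIntegrable_vorticity {M : ℝ} (hM : ∀ n, |a n| ≤ M) :
    LocallyIntegrable (vorticity a) := fun x =>
  ⟨Metric.ball x 1, Metric.ball_mem_nhds x one_pos,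
    Measure.integrableOn_of_bounded measure_ball_lt_top.ne
      (measurable_vorticity a).aestronglyMeasurable
      (ae_of_all _ fun x => by rw [vorticity_eq]; exact hM _)⟩

lemma memHNegOneLoc_zero : MemHNegOneLoc 0 := fun _ => ⟨0, fun φ _ => by simp⟩

lemma integral_abs_le_sqrt_mul {f : Plane → ℝ} (hf : Continuous f) (hc : HasCompactSupport f)
    {R : ℝ} (hzero : ∀ x, x ∉ Metric.ball (0 : Plane) R → f x = 0) :
    ∫ x, |f x| ≤ √(volume.real (Metric.ball (0 : Plane) R)) * √(∫ x, (f x) ^ 2) := by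
  have := isFiniteMeasure_restrict_ball R
  have hf2 : MemLp f 2 ((volume : Measure Plane).restrict (Metric.ball 0 R)) :=
    (hf.memLp_of_hasCompactSupport hc).restrict _
  have h1 := integral_mul_norm_le_Lp_mul_Lq
    (μ := (volume : Measure Plane).restrict (Metric.ball 0 R))
    (p := 2) (q := 2) (f := fun _ => (1 : ℝ)) (g := f) Real.HolderConjugate.two_two
    (memLp_const 1) (by simpa using hf2)
  simp only [norm_one, one_mul, norm_eq_abs, rpow_ofNat, sq_abs, one_pow] at h1
  rw [setIntegral_eq_integral_of_forall_compl_eq_zero (f := fun x => |f x|)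
      fun x hx => by rw [hzero x hx, abs_zero],
    setIntegral_eq_integral_of_forall_compl_eq_zero (f := fun x => f x ^ 2)
      fun x hx => by rw [hzero x hx]; simp,
    ← sqrt_eq_rpow, ← sqrt_eq_rpow, setIntegral_const, smul_eq_mul, mul_one] at h1
  exact h1

lemma memHNegOneLoc_vorticity {M : ℝ} (hM : ∀ n, |a n| ≤ M) :
    MemHNegOneLoc (toDistribution (vorticity a)) := by
  intro R
  set B := Metric.ball (0 : Plane) R with hB
  have hM0 : 0 ≤ M := (abs_nonneg _).trans (hM 0)
  refine ⟨M * √(volume.real B), fun φ hφ => ?_⟩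
  rw [toDistribution_apply (locallyIntegrable_vorticity hM)]
  have hcont : Continuous φ := φ.contDiff.continuous
  have hφi : Integrable φ := hcont.integrable_of_hasCompactSupport φ.hasCompactSupport
  have hcs : ∫ x, |φ x| ≤ √(volume.real B) * √(∫ x, (φ x) ^ 2) :=
    integral_abs_le_sqrt_mul hcont φ.hasCompactSupport fun x hx =>
      image_eq_zero_of_notMem_tsupport fun h => hx (hφ h)
  have hsob : √(∫ x, (φ x) ^ 2) ≤ sobolevNorm φ :=
    sqrt_le_sqrt (le_add_of_nonneg_right (integral_nonneg fun x => by positivity))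
  calc |∫ x, φ x * vorticity a x| ≤ ∫ x, |φ x * vorticity a x| := abs_integral_le_integral_abs
    _ ≤ ∫ x, M * |φ x| := by
        refine integral_mono_of_nonneg (ae_of_all _ fun x => abs_nonneg _)
          (hφi.abs.const_mul M) (ae_of_all _ fun x => ?_)
        simp only [abs_mul, vorticity_eq]
        rw [mul_comm]
        gcongr
        exact hM _
    _ = M * ∫ x, |φ x| := integral_const_mul _ _
    _ ≤ M * (√(volume.real B) * √(∫ x, (φ x) ^ 2)) := by gcongr
    _ ≤ M * (√(volume.real B) * sobolevNorm φ) := by gcongr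
    _ = _ := by ring

/-- The `L²_loc` limit of the partial sums is a velocity field with vorticity `vorticity a`. -/
lemma IsLimitOfPatchSums.isVelocityOf (h : IsLimitOfPatchSums a u) (hu : Measurable u) {M : ℝ}
    (hM : ∀ n, |a n| ≤ M) : IsVelocityOf (vorticity a) u := by
  have hloc := (h.memL2Loc hu).locallyIntegrable
  have hdiv : distDiv u = 0 := by
    ext φ
    rw [distDiv_apply hloc]
    have := integral_fderiv_eq_vorticity kernelPairing_id h hu hM (contDiff_one_testFunction φ)
      φ.hasCompactSupport
    simp only [ContinuousLinearMap.id_apply, zero_mul] at this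
    rw [this, neg_zero]
    rfl
  have hcurl : distCurl u = toDistribution (vorticity a) := by
    ext φ
    rw [distCurl_apply hloc, toDistribution_apply (locallyIntegrable_vorticity hM)]
    have := integral_fderiv_eq_vorticity kernelPairing_perp h hu hM (contDiff_one_testFunction φ)
      φ.hasCompactSupport
    simpa only [perpCLM_apply, one_mul] using this
  refine ⟨h.memL2Loc hu, ?_, ?_⟩
  · rw [hdiv]; exact ⟨memHNegOneLoc_zero, memHNegOneLoc_zero, rfl⟩
  · rw [hcurl]; exact ⟨memHNegOneLoc_vorticity hM, memHNegOneLoc_vorticity hM, rfl⟩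

end

section

/-! ### Fields without divergence and curl are holomorphic -/

/-- The complex number `z₁ - i z₂` attached to a vector. -/
def conjComplex : Plane →L[ℝ] ℂ :=
  Complex.ofRealCLM.comp (EuclideanSpace.proj (𝕜 := ℝ) (0 : Fin 2)) -
    Complex.I • Complex.ofRealCLM.comp (EuclideanSpace.proj (𝕜 := ℝ) (1 : Fin 2))

lemma conjComplex_apply (z : Plane) : conjComplex z = (z 0 : ℂ) - Complex.I * (z 1 : ℂ) := by
  simp [conjComplex]

lemma conjComplex_injective : Function.Injective conjComplex := by
  intro z w h
  rw [conjComplex_apply, conjComplex_apply] at h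
  have h0 := congrArg Complex.re h
  have h1 := congrArg Complex.im h
  simp at h0 h1
  ext i; fin_cases i <;> assumption

lemma enorm_conjComplex_le (z : Plane) : ‖conjComplex z‖ₑ ≤ ENNReal.ofReal 2 * ‖z‖ₑ := by
  have h : ‖conjComplex z‖ ≤ 2 * ‖z‖ := by
    rw [conjComplex_apply]
    refine (norm_sub_le _ _).trans ?_
    simp only [norm_mul, Complex.norm_I, one_mul, Complex.norm_real, norm_eq_abs]
    linarith [abs_apply_le_norm z 0, abs_apply_le_norm z 1]
  rw [← ofReal_norm, ← ofReal_norm, ← ENNReal.ofReal_mul (by norm_num)]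
  exact ENNReal.ofReal_le_ofReal h

/-- The identification of the complex numbers with the plane. -/
def ofComplex : ℂ →L[ℝ] Plane :=
  Complex.reCLM.smulRight (basisVec 0) + Complex.imCLM.smulRight (basisVec 1)

lemma ofComplex_one : ofComplex 1 = basisVec 0 := by simp [ofComplex]

lemma ofComplex_I : ofComplex Complex.I = basisVec 1 := by simp [ofComplex]

lemma ofComplex_surjective (x : Plane) : ∃ z, ofComplex z = x :=
  ⟨⟨x 0, x 1⟩, by simp [ofComplex, ← eq_basisVec_combination]⟩

lemma norm_ofComplex (z : ℂ) : ‖ofComplex z‖ = ‖z‖ := by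
  rw [EuclideanSpace.norm_eq, Complex.norm_eq_sqrt_sq_add_sq]
  simp [ofComplex, basisVec, Fin.sum_univ_two]

/-- The field `f` has vanishing divergence and curl in the sense of distributions. -/
def WeaklyIrrotational (f : Plane → Plane) : Prop :=
  ∀ φ : Plane → ℝ, ContDiff ℝ ((⊤ : ℕ∞) : WithTop ℕ∞) φ → HasCompactSupport φ →
    ∫ x, fderiv ℝ φ x (f x) = 0 ∧ ∫ x, fderiv ℝ φ x (perp (f x)) = 0

/-- The mollification of `f`, as a complex-valued function. -/
def mollify (ρ : Plane → ℝ) (f : Plane → Plane) (x : Plane) : ℂ :=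
  ∫ t, ρ t • conjComplex (f (x - t))

variable {f : Plane → Plane} {ρ : Plane → ℝ}

lemma locallyIntegrable_conjComplex (hf : LocallyIntegrable f) :
    LocallyIntegrable fun x => conjComplex (f x) := fun x => by
  obtain ⟨s, hs, hi⟩ := hf x
  exact ⟨s, hs, conjComplex.integrable_comp hi⟩

lemma integral_fderiv_shift (L : Plane →L[ℝ] Plane) (hρ : Differentiable ℝ ρ) (x : Plane) :
    ∫ t, fderiv ℝ ρ t (L (f (x - t))) =
      -∫ y, fderiv ℝ (fun y => ρ (x - y)) y (L (f y)) := by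
  rw [← integral_neg, ← integral_sub_left_eq_self _ volume x]
  congr 1
  ext1 y
  have h : HasFDerivAt (fun y => ρ (x - y)) ((fderiv ℝ ρ (x - y)).comp (-.id ℝ Plane)) y :=
    (hρ (x - y)).hasFDerivAt.comp y ((hasFDerivAt_id y).const_sub x)
  rw [h.fderiv]
  simp

lemma WeaklyIrrotational.integral_fderiv (hw : WeaklyIrrotational f)
    (hρ : ContDiff ℝ ((⊤ : ℕ∞) : WithTop ℕ∞) ρ) (hc : HasCompactSupport ρ) (x : Plane) :
    ∫ t, fderiv ℝ ρ t (f (x - t)) = 0 ∧ ∫ t, fderiv ℝ ρ t (perp (f (x - t))) = 0 := by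
  have h := hw (fun y => ρ (x - y)) (hρ.comp (by fun_prop))
    (hc.comp_homeomorph (Homeomorph.subLeft x))
  have hd : Differentiable ℝ ρ := hρ.differentiable (by simp)
  have h1 := integral_fderiv_shift (f := f) (.id ℝ Plane) hd x
  have h2 := integral_fderiv_shift (f := f) perpCLM hd x
  simp only [ContinuousLinearMap.id_apply, perpCLM_apply] at h1 h2
  rw [h1, h2, h.1, h.2]
  simp

/-- For `u₁ - i u₂` the Cauchy–Riemann equations say precisely that divergence and curl vanish.
Mollification makes the weak equations classical. -/
lemma differentiable_mollify (hf : LocallyIntegrable f) (hw : WeaklyIrrotational f)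
    (hρ : ContDiff ℝ ((⊤ : ℕ∞) : WithTop ℕ∞) ρ) (hc : HasCompactSupport ρ) :
    Differentiable ℂ fun z : ℂ => mollify ρ f (ofComplex z) := by
  intro z
  have hF := locallyIntegrable_conjComplex hf
  have hρ1 : ContDiff ℝ 1 ρ := hρ.of_le (by exact_mod_cast le_top)
  have hd := hρ1.continuous_fderiv one_ne_zero
  have hder := hc.hasFDerivAt_convolution_left (ContinuousLinearMap.lsmul ℝ ℝ) hρ1 hF
    (ofComplex z)
  set D := (convolution (fderiv ℝ ρ) (fun x => conjComplex (f x))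
    ((ContinuousLinearMap.lsmul ℝ ℝ).precompL Plane) volume (ofComplex z)) with hD
  have hint := (hc.fderiv ℝ).convolutionExists_left
    ((ContinuousLinearMap.lsmul ℝ ℝ : ℝ →L[ℝ] ℂ →L[ℝ] ℂ).precompL Plane) hd hF (ofComplex z)
  have hDv : ∀ v, D v = ∫ t, fderiv ℝ ρ t v • conjComplex (f (ofComplex z - t)) := fun v =>
    ContinuousLinearMap.integral_apply hint v
  have hintv : ∀ v, Integrable fun t => fderiv ℝ ρ t v • conjComplex (f (ofComplex z - t)) :=
    fun v => (ContinuousLinearMap.apply ℝ ℂ v).integrable_comp hint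
  have hcomp : HasFDerivAt (fun z : ℂ => mollify ρ f (ofComplex z)) (D.comp ofComplex) z :=
    hder.comp z ofComplex.hasFDerivAt
  rw [differentiableAt_complex_iff_differentiableAt_real]
  refine ⟨hcomp.differentiableAt, ?_⟩
  rw [hcomp.fderiv]
  simp only [ContinuousLinearMap.comp_apply, ofComplex_one, ofComplex_I]
  rw [hDv, hDv, smul_eq_mul, ← integral_const_mul, ← sub_eq_zero,
    ← integral_sub (hintv _) ((hintv _).const_mul _)]
  -- The Cauchy–Riemann defect is the curl pairing minus `i` times the divergence pairing.
  have hpt : ∀ t, fderiv ℝ ρ t (basisVec 1) • conjComplex (f (ofComplex z - t)) -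
      Complex.I * (fderiv ℝ ρ t (basisVec 0) • conjComplex (f (ofComplex z - t))) =
      ((fderiv ℝ ρ t (perp (f (ofComplex z - t))) : ℝ) : ℂ) -
        Complex.I * ((fderiv ℝ ρ t (f (ofComplex z - t)) : ℝ) : ℂ) := by
    intro t
    set w := f (ofComplex z - t)
    have e1 : fderiv ℝ ρ t w =
        w 0 * fderiv ℝ ρ t (basisVec 0) + w 1 * fderiv ℝ ρ t (basisVec 1) := by
      conv_lhs => rw [eq_basisVec_combination w]
      simp only [map_add, map_smul, smul_eq_mul]
    have e2 : fderiv ℝ ρ t (perp w) =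
        -w 1 * fderiv ℝ ρ t (basisVec 0) + w 0 * fderiv ℝ ρ t (basisVec 1) := by
      conv_lhs => rw [eq_basisVec_combination (perp w)]
      simp only [map_add, map_smul, smul_eq_mul]
      simp [perp]
    rw [e1, e2, conjComplex_apply]
    simp only [Complex.real_smul]
    push_cast
    linear_combination (fderiv ℝ ρ t (basisVec 0) * w 1 : ℂ) * Complex.I_sq
  simp only [hpt]
  have hfx : LocallyIntegrable fun t => f (ofComplex z - t) := by
    intro t
    obtain ⟨s, hs, hi⟩ := hf (ofComplex z - t)
    refine ⟨(fun t => ofComplex z - t) ⁻¹' s,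
      (by fun_prop : Continuous fun t : Plane => ofComplex z - t).continuousAt.preimage_mem_nhds
        hs, ?_⟩
    exact ((volume.measurePreserving_sub_left (ofComplex z)).integrableOn_comp_preimage
      (Homeomorph.subLeft (ofComplex z)).measurableEmbedding).2 hi
  have h := hw.integral_fderiv hρ hc (ofComplex z)
  rw [integral_sub, integral_const_mul, integral_complex_ofReal, integral_complex_ofReal, h.1, h.2]
  · simp
  · exact (integrable_fderiv_apply hρ1 hc perpCLM hfx).ofReal
  · exact ((integrable_fderiv_apply hρ1 hc (.id ℝ Plane) hfx).ofReal).const_mul _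

/-! ### A Liouville theorem for circle means -/

/-- Cauchy's formula for the derivative of `G - G 0`. The circle stays at distance at least `R/2`
from `z`, and `(1/2π) · R · 4/R² ≤ 1/R`. -/
lemma enorm_deriv_le_lintegral_circle {G : ℂ → ℂ} (hG : Differentiable ℂ G) {R : ℝ} (hR : 0 < R)
    {z : ℂ} (hz : 2 * ‖z‖ < R) :
    ‖deriv G z‖ₑ ≤ ENNReal.ofReal (1 / R) *
      ∫⁻ θ in Set.Ioc 0 (2 * π), ‖G (circleMap 0 R θ) - G 0‖ₑ := by
  have hz' : z ∈ Metric.ball (0 : ℂ) R := by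
    rw [mem_ball_zero_iff]; linarith [norm_nonneg z]
  have h := Complex.two_pi_I_inv_smul_circleIntegral_sub_sq_inv_smul_of_differentiable
    isOpen_univ (Set.subset_univ _) (hG.sub_const (G 0)).differentiableOn hz'
  rw [deriv_sub_const] at h
  rw [← h, circleIntegral, intervalIntegral.integral_of_le (by positivity), ← integral_smul]
  refine (enorm_integral_le_lintegral_enorm _).trans ?_
  rw [← lintegral_const_mul']
  swap
  · exact ENNReal.ofReal_ne_top
  apply lintegral_mono
  intro θ
  dsimp only
  rw [← ofReal_norm, ← ofReal_norm, ← ENNReal.ofReal_mul (by positivity)]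
  apply ENNReal.ofReal_le_ofReal
  simp only [norm_smul, norm_inv, norm_pow, norm_mul, deriv_circleMap, norm_circleMap_zero,
    Complex.norm_I, mul_one, Complex.norm_real, Complex.norm_ofNat]
  rw [norm_of_nonneg pi_pos.le, abs_of_pos hR]
  have h1 : R / 2 ≤ ‖circleMap 0 R θ - z‖ := by
    have := norm_sub_norm_le (circleMap 0 R θ) z
    rw [norm_circleMap_zero, abs_of_pos hR] at this
    linarith
  have h2 : (‖circleMap 0 R θ - z‖ ^ 2)⁻¹ ≤ ((R / 2) ^ 2)⁻¹ := by gcongr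
  have h3 : (2 * π)⁻¹ * (R * ((R / 2) ^ 2)⁻¹) ≤ 1 / R := by
    have : (2 * π)⁻¹ ≤ 1 / 4 := by
      rw [inv_le_comm₀ (by positivity) (by norm_num)]
      have := pi_gt_three
      norm_num; linarith
    calc _ ≤ 1 / 4 * (R * ((R / 2) ^ 2)⁻¹) := by gcongr
      _ = _ := by field_simp; norm_num
  calc _ = (2 * π)⁻¹ * (R * (‖circleMap 0 R θ - z‖ ^ 2)⁻¹) * ‖G (circleMap 0 R θ) - G 0‖ := by
        ring
    _ ≤ (2 * π)⁻¹ * (R * ((R / 2) ^ 2)⁻¹) * ‖G (circleMap 0 R θ) - G 0‖ := by gcongr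
    _ ≤ _ := by gcongr

lemma eq_of_liminf_circle_eq_zero {G : ℂ → ℂ} (hG : Differentiable ℂ G)
    (h : liminf (fun n : ℕ => ENNReal.ofReal (1 / ((n : ℝ) + 1)) *
      ∫⁻ θ in Set.Ioc 0 (2 * π), ‖G (circleMap 0 ((n : ℝ) + 1) θ) - G 0‖ₑ) atTop = 0) (z : ℂ) :
    G z = G 0 := by
  refine is_const_of_deriv_eq_zero hG (fun z => ?_) z 0
  rw [← enorm_eq_zero, ← nonpos_iff_eq_zero, ← h]
  refine le_liminf_of_le (by isBoundedDefault) ?_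
  obtain ⟨N, hN⟩ := exists_nat_gt (2 * ‖z‖)
  filter_upwards [eventually_ge_atTop N] with n hn
  have : (N : ℝ) ≤ n := by exact_mod_cast hn
  exact enorm_deriv_le_lintegral_circle hG (by positivity) (by linarith)

end

section

/-! ### Uniqueness -/

lemma weaklyIrrotational_sub {ω : Plane → ℝ} {u w : Plane → Plane} (hw : IsVelocityOf ω w)
    (hu : IsVelocityOf ω u) : WeaklyIrrotational fun x => w x - u x := by
  intro φ hφ hc
  set Φ : 𝓓((⊤ : TopologicalSpace.Opens Plane), ℝ) := ⟨φ, hφ, hc, fun _ _ => trivial⟩ with hΦ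
  have hφ1 : ContDiff ℝ 1 φ := contDiff_one_testFunction Φ
  have lw := hw.memL2Loc.locallyIntegrable
  have lu := hu.memL2Loc.locallyIntegrable
  have hsub : ∀ L : Plane →L[ℝ] Plane, ∫ x, fderiv ℝ φ x (L (w x - u x)) =
      (∫ x, fderiv ℝ φ x (L (w x))) - ∫ x, fderiv ℝ φ x (L (u x)) := fun L => by
    rw [← integral_sub (integrable_fderiv_apply hφ1 hc L lw) (integrable_fderiv_apply hφ1 hc L lu)]
    simp only [map_sub]
  have h1 : distDiv w Φ = distDiv u Φ := by rw [hw.div_eq.2.2, hu.div_eq.2.2]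
  have h2 : distCurl w Φ = distCurl u Φ := by rw [hw.curl_eq.2.2, hu.curl_eq.2.2]
  rw [distDiv_apply lw, distDiv_apply lu, neg_inj] at h1
  rw [distCurl_apply lw, distCurl_apply lu] at h2
  refine ⟨?_, ?_⟩
  · exact (hsub (.id ℝ Plane)).trans (sub_eq_zero.2 h1)
  · exact (hsub perpCLM).trans (sub_eq_zero.2 h2)

/-- A sequence of bump functions concentrating at the origin. -/
def bump (m : ℕ) : ContDiffBump (0 : Plane) where
  rIn := 1 / (2 * (m + 1))
  rOut := 1 / (m + 1)
  rIn_pos := by positivity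
  rIn_lt_rOut := one_div_lt_one_div_of_lt (by positivity) (by
    have : (0 : ℝ) < m + 1 := by positivity
    linarith)

/-- The mollifiers associated with `bump`. -/
def mollifier (m : ℕ) : Plane → ℝ := (bump m).normed volume

lemma contDiff_mollifier (m : ℕ) : ContDiff ℝ ((⊤ : ℕ∞) : WithTop ℕ∞) (mollifier m) :=
  (bump m).contDiff_normed

lemma hasCompactSupport_mollifier (m : ℕ) : HasCompactSupport (mollifier m) :=
  (bump m).hasCompactSupport_normed

lemma mollifier_eq_zero {m : ℕ} {t : Plane} (ht : 1 < ‖t‖) : mollifier m t = 0 := by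
  have h : t ∉ Function.support (mollifier m) := by
    rw [mollifier, (bump m).support_normed_eq, mem_ball_zero_iff, not_lt]
    refine le_trans ?_ ht.le
    change 1 / ((m : ℝ) + 1) ≤ 1
    rw [div_le_one (by positivity)]
    have : (0 : ℝ) ≤ m := by positivity
    linarith
  simpa using h

/-- Mollifications converge almost everywhere, so every point of convergence can be compared with
one fixed such point. Injectivity of `conjComplex` returns to the plane. -/
lemma ae_eq_const_of_mollify_eq_const {f : Plane → Plane} (hf : LocallyIntegrable f)
    (h : ∀ m x, mollify (mollifier m) f x = mollify (mollifier m) f 0) :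
    ∃ c, ∀ᵐ x : Plane, f x = c := by
  have hlim : ∀ᵐ x : Plane, Tendsto (fun m => mollify (mollifier m) f x) atTop
      (𝓝 (conjComplex (f x))) :=
    -- Convergence almost everywhere needs a bounded ratio of outer to inner radius; here it is
    -- exactly `2`.
    ContDiffBump.ae_convolution_tendsto_right_of_locallyIntegrable (φ := bump) (l := atTop) (K := 2)
      tendsto_one_div_add_atTop_nhds_zero_nat (Eventually.of_forall fun m => by
        change 1 / ((m : ℝ) + 1) ≤ 2 * (1 / (2 * ((m : ℝ) + 1)))
        apply le_of_eq
        field_simp) (locallyIntegrable_conjComplex hf)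
  obtain ⟨x₀, hx₀⟩ := hlim.exists
  refine ⟨f x₀, hlim.mono fun x hx => conjComplex_injective (tendsto_nhds_unique hx ?_)⟩
  simpa only [h _ x₀, ← h _ x] using hx₀

/-- Deliberately crude: the uniqueness argument needs only sublinear growth. -/
lemma growthModulus_le (x y : Plane) : growthModulus x y ≤ √(2 + ‖x‖ + ‖y‖) := by
  have h0 := norm_nonneg (x - y)
  have h1 : ‖x - y‖ * (1 + logNeg ‖x - y‖) / (1 + ‖x - y‖) ≤ 1 := by
    rw [div_le_one (by positivity)]
    exact mul_one_add_logNeg_le h0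
  have h2 : log (exp 1 + ‖x‖ + ‖y‖) ≤ 2 + ‖x‖ + ‖y‖ := by
    have h3 := log_le_sub_one_of_pos (show 0 < exp 1 + ‖x‖ + ‖y‖ by positivity)
    have := exp_one_lt_d9
    linarith
  unfold growthModulus
  calc _ ≤ 1 * √(log (exp 1 + ‖x‖ + ‖y‖)) := by gcongr
    _ ≤ _ := by rw [one_mul]; exact sqrt_le_sqrt h2

variable {Ω : Type*} [MeasurableSpace Ω] {μ : Measure Ω} [IsProbabilityMeasure μ]
  {f : Ω → Plane → Plane}

lemma IncrementBound.lintegral_le {u : Ω → Plane → Plane} (hu : Measurable (Function.uncurry u))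
    {p C : ℝ} (hp : 1 ≤ p) (h : IncrementBound μ u p C) (x y : Plane) :
    ∫⁻ ω, ‖u ω x - u ω y‖ₑ ∂μ ≤ ENNReal.ofReal (|C| * √(2 + ‖x‖ + ‖y‖)) := by
  rw [← eLpNorm_one_eq_lintegral_enorm]
  calc _ ≤ eLpNorm (fun ω => u ω x - u ω y) (ENNReal.ofReal p) μ :=
        eLpNorm_le_eLpNorm_of_exponent_le (by simpa using hp)
          ((hu.of_uncurry_right (y := x)).sub (hu.of_uncurry_right (y := y))).aestronglyMeasurable
    _ ≤ _ := h x y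
    _ ≤ _ := by
        have := growthModulus_nonneg x y
        apply ENNReal.ofReal_le_ofReal
        gcongr
        · exact le_abs_self C
        · exact growthModulus_le x y

lemma lintegral_sub_field_le {u w : Ω → Plane → Plane} (hw : Measurable (Function.uncurry w))
    (hu : Measurable (Function.uncurry u)) {p q C D : ℝ} (hp : 1 ≤ p) (hq : 1 ≤ q)
    (hC : IncrementBound μ w p C) (hD : IncrementBound μ u q D) (x y : Plane) :
    ∫⁻ ω, ‖(w ω x - u ω x) - (w ω y - u ω y)‖ₑ ∂μ ≤
      ENNReal.ofReal ((|C| + |D|) * √(2 + ‖x‖ + ‖y‖)) := by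
  calc _ ≤ ∫⁻ ω, (‖w ω x - w ω y‖ₑ + ‖u ω x - u ω y‖ₑ) ∂μ := by
        apply lintegral_mono
        intro ω
        dsimp only
        rw [sub_sub_sub_comm]
        exact enorm_sub_le
    _ = (∫⁻ ω, ‖w ω x - w ω y‖ₑ ∂μ) + ∫⁻ ω, ‖u ω x - u ω y‖ₑ ∂μ :=
        lintegral_add_left ((hw.of_uncurry_right (y := x)).sub (hw.of_uncurry_right (y := y))).enorm _
    _ ≤ _ := add_le_add (hC.lintegral_le hw hp x y) (hD.lintegral_le hu hq x y)
    _ = _ := by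
        rw [← ENNReal.ofReal_add (by positivity) (by positivity), add_mul]

lemma stronglyMeasurable_mollify (hf : Measurable (Function.uncurry f)) {ρ : Plane → ℝ}
    (hρ : Continuous ρ) :
    StronglyMeasurable fun q : Ω × Plane => mollify ρ (f q.1) q.2 := by
  have h1 : Measurable fun q : (Ω × Plane) × Plane => f q.1.1 (q.1.2 - q.2) :=
    hf.comp ((measurable_fst.comp measurable_fst).prodMk
      ((measurable_snd.comp measurable_fst).sub measurable_snd))
  have h2 : StronglyMeasurable fun q : (Ω × Plane) × Plane =>
      ρ q.2 • conjComplex (f q.1.1 (q.1.2 - q.2)) :=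
    (hρ.measurable.comp measurable_snd).stronglyMeasurable.smul
      (conjComplex.continuous.comp_stronglyMeasurable h1.stronglyMeasurable)
  exact h2.integral_prod_right'

/-- Mollification averages increments between `x - t` and `-t`, so the bound in mean survives. As
`|t| ≤ 1`, the two norms add at most `2` to `|x|`. -/
lemma lintegral_mollify_sub_le (hf : Measurable (Function.uncurry f))
    (hloc : ∀ᵐ ω ∂μ, LocallyIntegrable (f ω)) {C : ℝ} (hC : 0 ≤ C)
    (hinc : ∀ x y, ∫⁻ ω, ‖f ω x - f ω y‖ₑ ∂μ ≤ ENNReal.ofReal (C * √(2 + ‖x‖ + ‖y‖)))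
    {ρ : Plane → ℝ} (hρ : Continuous ρ) (hc : HasCompactSupport ρ)
    (hsupp : ∀ t, 1 < ‖t‖ → ρ t = 0) (x : Plane) :
    ∫⁻ ω, ‖mollify ρ (f ω) x - mollify ρ (f ω) 0‖ₑ ∂μ ≤
      (∫⁻ t, ‖ρ t‖ₑ) * ENNReal.ofReal (2 * C * √(4 + ‖x‖)) := by
  have hshift : ∀ x, Measurable fun q : Ω × Plane => f q.1 (x - q.2) := fun x =>
    hf.comp (measurable_fst.prodMk (measurable_snd.const_sub x))
  have hmeas : Measurable fun q : Ω × Plane => ‖f q.1 (x - q.2) - f q.1 (0 - q.2)‖ₑ :=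
    ((hshift x).sub (hshift 0)).enorm
  have hρm : Measurable fun t => ‖ρ t‖ₑ := hρ.measurable.enorm
  calc _ ≤ ∫⁻ ω, (∫⁻ t, ‖ρ t‖ₑ * (ENNReal.ofReal 2 * ‖f ω (x - t) - f ω (0 - t)‖ₑ)) ∂μ := by
        apply lintegral_mono_ae
        filter_upwards [hloc] with ω hω
        have hint : ∀ x, Integrable fun t => ρ t • conjComplex (f ω (x - t)) := fun x =>
          hc.convolutionExists_left (ContinuousLinearMap.lsmul ℝ ℝ) hρ
            (locallyIntegrable_conjComplex hω) x
        unfold mollify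
        rw [← integral_sub (hint x) (hint 0)]
        refine (enorm_integral_le_lintegral_enorm _).trans (lintegral_mono fun t => ?_)
        dsimp only
        rw [← smul_sub, ← map_sub, enorm_smul]
        gcongr
        exact enorm_conjComplex_le _
    _ = ∫⁻ t, ∫⁻ ω, ‖ρ t‖ₑ * (ENNReal.ofReal 2 * ‖f ω (x - t) - f ω (0 - t)‖ₑ) ∂μ :=
        lintegral_lintegral_swap (((hρm.comp measurable_snd).mul
          (hmeas.const_mul _)).aemeasurable)
    _ ≤ ∫⁻ t, ‖ρ t‖ₑ * ENNReal.ofReal (2 * C * √(4 + ‖x‖)) := by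
        apply lintegral_mono
        intro t
        dsimp only
        have hm : Measurable fun ω => ‖f ω (x - t) - f ω (0 - t)‖ₑ :=
          ((hf.of_uncurry_right (y := x - t)).sub (hf.of_uncurry_right (y := 0 - t))).enorm
        rw [lintegral_const_mul _ (hm.const_mul _), lintegral_const_mul _ hm]
        by_cases ht : 1 < ‖t‖
        · simp [hsupp t ht]
        · push Not at ht
          rw [mul_assoc 2 C, ENNReal.ofReal_mul zero_le_two]
          gcongr
          refine (hinc _ _).trans (ENNReal.ofReal_le_ofReal ?_)
          have h1 := norm_sub_le x t
          have h2 : ‖0 - t‖ = ‖t‖ := by rw [zero_sub, norm_neg]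
          have h3 : √(2 + ‖x - t‖ + ‖0 - t‖) ≤ √(4 + ‖x‖) := sqrt_le_sqrt (by linarith)
          exact mul_le_mul_of_nonneg_left h3 hC
    _ = _ := lintegral_mul_const _ hρm

lemma tendsto_one_div_mul_sqrt :
    Tendsto (fun n : ℕ => 1 / ((n : ℝ) + 1) * √(4 + ((n : ℝ) + 1))) atTop (𝓝 0) := by
  have h1 : Tendsto (fun n : ℕ => √5 / √((n : ℝ) + 1)) atTop (𝓝 0) :=
    tendsto_const_nhds.div_atTop
      (tendsto_sqrt_atTop.comp (tendsto_atTop_add_const_right _ _ tendsto_natCast_atTop_atTop))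
  refine squeeze_zero (fun n => by positivity) (fun n => ?_) h1
  have h2 : √(4 + ((n : ℝ) + 1)) ≤ √5 * √((n : ℝ) + 1) := by
    rw [← sqrt_mul (by norm_num)]
    apply sqrt_le_sqrt
    have : (0 : ℝ) ≤ n := by positivity
    linarith
  have h3 : 0 < √((n : ℝ) + 1) := by positivity
  calc _ ≤ 1 / ((n : ℝ) + 1) * (√5 * √((n : ℝ) + 1)) := by gcongr
    _ = 1 / (√((n : ℝ) + 1) * √((n : ℝ) + 1)) * (√5 * √((n : ℝ) + 1)) := by
        rw [mul_self_sqrt (by positivity)]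
    _ = _ := by field_simp

/-- By Tonelli the expected values are `O(R^{-1/2})` at radius `R = n + 1`, and Fatou's lemma brings
the liminf inside the expectation. -/
lemma ae_liminf_circle_eq_zero (hf : Measurable (Function.uncurry f))
    (hloc : ∀ᵐ ω ∂μ, LocallyIntegrable (f ω)) {C : ℝ} (hC : 0 ≤ C)
    (hinc : ∀ x y, ∫⁻ ω, ‖f ω x - f ω y‖ₑ ∂μ ≤ ENNReal.ofReal (C * √(2 + ‖x‖ + ‖y‖)))
    {ρ : Plane → ℝ} (hρ : Continuous ρ) (hc : HasCompactSupport ρ)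
    (hsupp : ∀ t, 1 < ‖t‖ → ρ t = 0) :
    ∀ᵐ ω ∂μ, liminf (fun n : ℕ => ENNReal.ofReal (1 / ((n : ℝ) + 1)) *
      ∫⁻ θ in Set.Ioc 0 (2 * π), ‖mollify ρ (f ω) (ofComplex (circleMap 0 ((n : ℝ) + 1) θ)) -
        mollify ρ (f ω) (ofComplex 0)‖ₑ) atTop = 0 := by
  set I := ∫⁻ t, ‖ρ t‖ₑ with hI
  have hIfin : I ≠ ∞ := (hρ.integrable_of_hasCompactSupport hc).2.ne
  have hgm := (stronglyMeasurable_mollify hf hρ).measurable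
  have hmeas : ∀ n : ℕ, Measurable fun q : Ω × ℝ =>
      ‖mollify ρ (f q.1) (ofComplex (circleMap 0 ((n : ℝ) + 1) q.2)) -
        mollify ρ (f q.1) (ofComplex 0)‖ₑ := fun n =>
    ((hgm.comp (measurable_fst.prodMk (ofComplex.continuous.measurable.comp
      ((continuous_circleMap 0 _).measurable.comp measurable_snd)))).sub
      (hgm.comp (measurable_fst.prodMk measurable_const))).enorm
  set A : ℕ → Ω → ℝ≥0∞ := fun n ω => ENNReal.ofReal (1 / ((n : ℝ) + 1)) *
    ∫⁻ θ in Set.Ioc 0 (2 * π), ‖mollify ρ (f ω) (ofComplex (circleMap 0 ((n : ℝ) + 1) θ)) -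
      mollify ρ (f ω) (ofComplex 0)‖ₑ with hA
  have hAm : ∀ n, Measurable (A n) := fun n => (hmeas n).lintegral_prod_right'.const_mul _
  have hbound : ∀ n, ∫⁻ ω, A n ω ∂μ ≤ ENNReal.ofReal (1 / ((n : ℝ) + 1) * √(4 + ((n : ℝ) + 1))) *
      (I * ENNReal.ofReal (2 * C) * ENNReal.ofReal (2 * π)) := by
    intro n
    simp only [hA]
    rw [lintegral_const_mul _ (hmeas n).lintegral_prod_right',
      lintegral_lintegral_swap (hmeas n).aemeasurable]
    calc _ ≤ ENNReal.ofReal (1 / ((n : ℝ) + 1)) * ∫⁻ _θ in Set.Ioc 0 (2 * π),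
          I * ENNReal.ofReal (2 * C * √(4 + ((n : ℝ) + 1))) := by
          gcongr with θ
          have h := lintegral_mollify_sub_le hf hloc hC hinc hρ hc hsupp
            (ofComplex (circleMap 0 ((n : ℝ) + 1) θ))
          rw [norm_ofComplex, norm_circleMap_zero, abs_of_pos (by positivity)] at h
          rwa [map_zero]
      _ = _ := by
          rw [setLIntegral_const, volume_Ioc, sub_zero, ENNReal.ofReal_mul (p := 2 * C)
            (by positivity), ENNReal.ofReal_mul (p := 1 / ((n : ℝ) + 1)) (by positivity)]
          ring
  have hlim : liminf (fun n => ∫⁻ ω, A n ω ∂μ) atTop = 0 := by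
    refine Tendsto.liminf_eq (tendsto_of_tendsto_of_tendsto_of_le_of_le tendsto_const_nhds ?_
      (fun _ => bot_le) hbound)
    have hK : I * ENNReal.ofReal (2 * C) * ENNReal.ofReal (2 * π) ≠ ∞ :=
      ENNReal.mul_ne_top (ENNReal.mul_ne_top hIfin ENNReal.ofReal_ne_top) ENNReal.ofReal_ne_top
    have := ENNReal.Tendsto.mul_const (ENNReal.tendsto_ofReal tendsto_one_div_mul_sqrt)
      (Or.inr hK)
    simpa using this
  have hle : ∫⁻ ω, liminf (fun n => A n ω) atTop ∂μ ≤ liminf (fun n => ∫⁻ ω, A n ω ∂μ) atTop :=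
    lintegral_liminf_le hAm
  have hAlim : Measurable fun ω => liminf (fun n => A n ω) atTop := Measurable.liminf hAm
  rw [hlim, nonpos_iff_eq_zero, lintegral_eq_zero_iff hAlim] at hle
  exact hle

/-- A random field that is almost surely free of divergence and curl and whose increments grow
sublinearly in mean is almost surely constant. -/
lemma ae_eq_const_of_weaklyIrrotational (hf : Measurable (Function.uncurry f))
    (hloc : ∀ᵐ ω ∂μ, LocallyIntegrable (f ω)) (hirr : ∀ᵐ ω ∂μ, WeaklyIrrotational (f ω))
    {C : ℝ} (hC : 0 ≤ C)
    (hinc : ∀ x y, ∫⁻ ω, ‖f ω x - f ω y‖ₑ ∂μ ≤ ENNReal.ofReal (C * √(2 + ‖x‖ + ‖y‖))) :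
    ∀ᵐ ω ∂μ, ∃ c, ∀ᵐ x : Plane, f ω x = c := by
  have hcirc := ae_all_iff.2 fun m => ae_liminf_circle_eq_zero hf hloc hC hinc
    (contDiff_mollifier m).continuous (hasCompactSupport_mollifier m) fun t => mollifier_eq_zero
  filter_upwards [hloc, hirr, hcirc] with ω h1 h2 h3
  refine ae_eq_const_of_mollify_eq_const h1 fun m x => ?_
  obtain ⟨z, rfl⟩ := ofComplex_surjective x
  have := eq_of_liminf_circle_eq_zero
    (differentiable_mollify h1 h2 (contDiff_mollifier m) (hasCompactSupport_mollifier m))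
    (h3 m) z
  simpa using this

end

end RandomVorticity

end

/-! ### Assembly of the theorem -/

open RandomVorticity in
theorem proposition3p1 (M : ℝ) :
    -- the constants depend only on the exponent and on the bound `M` for the weights
    ∃ C : ℝ → ℝ, ∀ (Ω : Type*) [MeasurableSpace Ω] (μ : Measure Ω) [IsProbabilityMeasure μ]
      (a : Lattice → Ω → ℝ),
      (∀ n, Measurable (a n)) →
      iIndepFun a μ →
      (∀ n, ∀ᵐ ω ∂μ, |a n ω| ≤ M) →
      (∀ n, ∫ ω, a n ω ∂μ = 0) →
      (∀ n, variance (a n) μ = 1) →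
      ∃ u : Ω → Plane → Plane,
        Measurable (Function.uncurry u) ∧
        -- the series converges to `u` in `L²(Ω × B_N)`, unconditionally, for every `N`
        (∀ N : ℕ,
          MemLp (Function.uncurry u) 2 (μ.prod (volume.restrict (Metric.ball (0 : Plane) N))) ∧
          Tendsto
            (fun s : Finset Lattice =>
              eLpNorm
                (fun z : Ω × Plane => u z.1 z.2 - ∑ n ∈ s, a n z.1 • renormalizedPatch n z.2) 2
                (μ.prod (volume.restrict (Metric.ball (0 : Plane) N))))
            atTop (𝓝 0)) ∧
        -- almost surely `u ∈ L²_loc`, `div u = 0` and `curl u` is the given random vorticity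
        (∀ᵐ ω ∂μ, IsVelocityOf (vorticity fun n => a n ω) (u ω)) ∧
        -- the moment bound
        (∀ p : ℝ, 1 ≤ p → IncrementBound μ u p (C p)) ∧
        -- uniqueness up to a (random) constant, among the random fields with these properties
        (∀ w : Ω → Plane → Plane,
          Measurable (Function.uncurry w) →
          (∀ᵐ ω ∂μ, IsVelocityOf (vorticity fun n => a n ω) (w ω)) →
          (∃ p : ℝ, 1 ≤ p ∧ ∃ C' : ℝ, IncrementBound μ w p C') →
          ∀ᵐ ω ∂μ, ∃ c : Plane, ∀ᵐ x : Plane, w ω x = u ω x + c) := by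
  refine ⟨fun p => momentConst M p * 6120, fun Ω _ μ _ a ha hind hM h0 _ => ?_⟩
  have hvel : ∀ᵐ ω ∂μ, IsVelocityOf (vorticity fun n => a n ω) (randomField a ω) := by
    filter_upwards [ae_tendsto_lintegral_sub_sq ha hind hM h0, ae_all_iff.2 hM] with ω h1 h2
    exact IsLimitOfPatchSums.isVelocityOf h1
      (measurable_randomField ha).of_uncurry_left h2
  refine ⟨randomField a, measurable_randomField ha,
    fun N => ⟨memLp_randomField ha hind hM h0 N, tendsto_eLpNorm_randomField_sub ha hind hM h0 N⟩,
    hvel, fun p hp => incrementBound_randomField ha hind hM h0 hp, ?_⟩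
  rintro w hw hwvel ⟨p, hp, C', hinc⟩
  have hm : Measurable (Function.uncurry fun ω x => w ω x - randomField a ω x) :=
    hw.sub (measurable_randomField ha)
  -- The two fields may satisfy their bounds with different exponents, `p` for `w` and `1` here for
  -- the constructed field; both reduce to first moments.
  have hdiff := ae_eq_const_of_weaklyIrrotational (μ := μ) hm
    (C := |C'| + |momentConst M 1 * 6120|)
    (by
      filter_upwards [hvel, hwvel] with ω h1 h2
      exact h2.memL2Loc.locallyIntegrable.sub h1.memL2Loc.locallyIntegrable)
    (by
      filter_upwards [hvel, hwvel] with ω h1 h2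
      exact weaklyIrrotational_sub h2 h1)
    (by positivity)
    (lintegral_sub_field_le hw (measurable_randomField ha) hp le_rfl hinc
      (incrementBound_randomField ha hind hM h0 le_rfl))
  filter_upwards [hdiff] with ω hω
  obtain ⟨c, hc⟩ := hω
  exact ⟨c, hc.mono fun x hx => by rw [← hx]; abel⟩
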